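/- Let $n\ge 1$, let $\theta\in\mathbb R$, and let $\varphi_\theta=\operatorname{Re}\bigl(e^{-i\theta}\,dz_1\wedge\dots\wedge dz_n\bigr)$ be the special Lagrangian (SL) form of phase $\theta$ on $\mathbb C^n\cong\mathbb R^{2n}$. An SL $n$-submanifold of phase $\theta$ is an oriented smooth embedded $n$-dimensional submanifold $M\subset\mathbb C^n$ with (possibly empty) boundary $\partial M$, not necessarily closed, compact or connected, such that $\varphi_\theta(\xi(x))=1$ for all $x\in M$, where $\xi(x)$ is the oriented unit tangent $n$-vector of $M$ at $x$. Theorem (Symmetry of SL submanifolds). Let $S$ be an SL $n$-submanifold of $\mathbb C^n$ of phase $\theta$ with orientation $\xi$, let $P\subset\mathbb C^n$ be a complex affine plane of real codimension two (complex codimension one), and let $L$ be a relatively open subset of $\partial S$ with $L\subset P$. Let $f$ be the orthogonal reflection in $P$ (the rotation by $\pi$ about $P$), let $S^*=f(S)$, and let $-S^*$ be $S^*$ with the orientation $-f_*\xi$. Orient $\Sigma=S\cup -S^*$ by $\xi$ at the points of $S$ and by $-f_*\xi$ at the points of $S^*\setminus S$. Then $S\cup -S^*$ is special Lagrangian, calibrated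 by the same form $\varphi_\theta$, and area-minimizing. Precisely: 1. $-S^*$ is an SL submanifold of the same phase $\theta$, with $\partial S^*=f(\partial S)$. 2. There is an open set $U\supset L$ such that $\Sigma\cap U$, with the above orientation, is an SL submanifold of phase $\theta$ without boundary. (Thus $S$ and $-S^*$ fit together smoothly across $L$, and $\Sigma$ is covered by the SL submanifolds $S$, $-S^*$ and $\Sigma\cap U$, all of phase $\theta$.) 3. If moreover $S\cap\overline{S^*}\subset L$ (the two pieces meet only along $L$), then $\Sigma$ is globally an embedded SL submanifold of phase $\theta$, with boundary $(\partial S\setminus L)\cup f(\partial S\setminus L)$. 4. The oriented unit $n$-vector of $\Sigma$ chosen above takes the value $1$ on $\varphi_\theta$ at every point of $\Sigma$. 5. $\Sigma$ is area-minimizing: for every bounded Borel set $A\subset\Sigma$ with $\mathcal H^n(A)<\infty$ (so for $A=\Sigma$ if $\Sigma$ is bounded and of finite area), and every compactly supported $n$-dimensional current $T$ in $\mathbb C^n$ with $\partial T=\partial[A]$, where $[A]$ is the current of integration over the oriented set $A$, one has $\mathcal H^n(A)\le \mathbf M(T)$, where $\mathbf M(T)$ is the mass of $T$. -/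

import Mathlib

open scoped ContDiff Distributions MeasureTheory

noncomputable section

namespace SpecialLagrangian

section General

variable {E : Type*} [NormedAddCommGroup E] [InnerProductSpace ℝ E]

/-! ### Embedded submanifolds with boundary -/

/-- Near `x`, the set `M` is a smooth embedded `d`-dimensional submanifold without boundary:
a smooth local diffeomorphism `Φ` of `E` around `x` flattens `M` to a `d`-dimensional linear
subspace `V`. -/
def IsInteriorPoint (d : ℕ) (M : Set E) (x : E) : Prop :=
  x ∈ M ∧ ∃ (Φ : OpenPartialHomeomorph E E) (V : Submodule ℝ E),
    x ∈ Φ.source ∧ ContDiffOn ℝ ∞ Φ Φ.source ∧ ContDiffOn ℝ ∞ Φ.symm Φ.target ∧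
    Module.finrank ℝ V = d ∧
    Φ '' (M ∩ Φ.source) = Φ.target ∩ {v | v ∈ V}

/-- Near `x`, the set `M` is a smooth embedded `d`-dimensional submanifold with boundary, and `x`
lies on the boundary: a smooth local diffeomorphism `Φ` of `E` around `x` flattens `M` to the closed
half `{0 ≤ ℓ}` of a `d`-dimensional linear subspace `V`, and maps `x` to the face `{ℓ = 0}`. -/
def IsBoundaryPoint (d : ℕ) (M : Set E) (x : E) : Prop :=
  x ∈ M ∧ ∃ (Φ : OpenPartialHomeomorph E E) (V : Submodule ℝ E) (ℓ : E →L[ℝ] ℝ),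
    x ∈ Φ.source ∧ ContDiffOn ℝ ∞ Φ Φ.source ∧ ContDiffOn ℝ ∞ Φ.symm Φ.target ∧
    Module.finrank ℝ V = d ∧ (∃ v ∈ V, ℓ v ≠ 0) ∧ ℓ (Φ x) = 0 ∧
    Φ '' (M ∩ Φ.source) = Φ.target ∩ {v | v ∈ V ∧ 0 ≤ ℓ v}

/-- `M` is a smooth embedded `d`-dimensional submanifold of `E` with (possibly empty) boundary.
It need be neither closed nor connected nor compact. -/
def IsSubmanifold (d : ℕ) (M : Set E) : Prop :=
  ∀ x ∈ M, IsInteriorPoint d M x ∨ IsBoundaryPoint d M x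

/-- The (manifold) boundary `∂M`. -/
def boundary (d : ℕ) (M : Set E) : Set E := {x | IsBoundaryPoint d M x}

/-- The tangent space of `M` at `x`, for `M` a submanifold with boundary. At a boundary point the
directions pointing into `M` fill a half-space only, and the span is the full tangent space. -/
def tangentSpace (M : Set E) (x : E) : Submodule ℝ E :=
  Submodule.span ℝ (tangentConeAt ℝ M x)

/-! ### Multivectors, orientations -/

variable (E) in
/-- `d`-vectors of `E`, realised as the dual of the space of alternating `d`-forms. -/
abbrev MultiVector (d : ℕ) : Type _ := (E [⋀^Fin d]→L[ℝ] ℝ) →L[ℝ] ℝ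

/-- The simple `d`-vector `v₁ ∧ ⋯ ∧ v_d`, i.e. `α ↦ α (v₁, …, v_d)`. -/
def wedge {d : ℕ} (v : Fin d → E) : MultiVector E d :=
  ContinuousAlternatingMap.apply ℝ E ℝ v

/-- An orientation of the `d`-dimensional submanifold `M`: a continuous field along `M` of unit
simple `d`-vectors, spanning the tangent space of `M` at each point. -/
def IsOrientation {d : ℕ} (M : Set E) (ξ : E → MultiVector E d) : Prop :=
  ContinuousOn ξ M ∧ ∀ x ∈ M, ∃ v : Fin d → E, Orthonormal ℝ v ∧
    Submodule.span ℝ (Set.range v) = tangentSpace M x ∧ ξ x = wedge v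

/-- The image `A_* ξ` of a `d`-vector under a linear map `A`: `(A_* ξ) α = ξ (A^* α)`. -/
def MultiVector.map {d : ℕ} (A : E →L[ℝ] E) (ξ : MultiVector E d) : MultiVector E d :=
  ξ.comp (ContinuousAlternatingMap.compContinuousLinearMapCLM A)

/-! ### Currents and area minimization -/

variable (E) in
/-- Smooth compactly supported differential `d`-forms on `E`. -/
abbrev TestForm (d : ℕ) : Type _ := 𝓓((⊤ : TopologicalSpace.Opens E), E [⋀^Fin d]→L[ℝ] ℝ)

variable (E) in
/-- `d`-dimensional currents in `E`. -/
abbrev Current (d : ℕ) : Type _ := TestForm E d →L[ℝ] ℝ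

/-- The current `T` has compact support. -/
def Current.HasCompactSupport {d : ℕ} (T : Current E d) : Prop :=
  ∃ K : Set E, IsCompact K ∧ ∀ α : TestForm E d, Disjoint (tsupport α) K → T α = 0

/-- The mass of a current: the supremum of its values on test forms of comass at most one. -/
def Current.mass {d : ℕ} (T : Current E d) : ENNReal :=
  ⨆ (α : TestForm E d) (_ : ∀ (x : E) (v : Fin d → E), Orthonormal ℝ v → |α x v| ≤ 1),
    ENNReal.ofReal (T α)

variable [MeasurableSpace E] [BorelSpace E]

/-- Integration of a form over the piece `A` of a `d`-dimensional submanifold with orientation `ξ`,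
with respect to `d`-dimensional area (Hausdorff measure, normalised to agree with Lebesgue
measure on `d`-planes). -/
def integrate {d : ℕ} (A : Set E) (ξ : E → MultiVector E d) (α : TestForm E d) : ℝ :=
  ∫ x in A, ξ x (α x) ∂(μHE[d] : MeasureTheory.Measure E)

/-- `∂T = ∂[A]`, where `[A]` is integration over the piece `A` with orientation `ξ`: the two
agree on all exact forms `α = dη` with `η` a test form. -/
def Current.HasBoundaryOf {k : ℕ} (T : Current E (k + 1)) (A : Set E)
    (ξ : E → MultiVector E (k + 1)) : Prop :=
  ∀ (η : TestForm E k) (α : TestForm E (k + 1)), (∀ x, α x = extDeriv η x) →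
    T α = integrate A ξ α

/-- The `(k+1)`-dimensional `M` with orientation `ξ` is area-minimizing: every bounded Borel piece
`A` of `M` of finite area has no more area than any compactly supported current with the same
boundary has mass. -/
def IsAreaMinimizing {k : ℕ} (M : Set E) (ξ : E → MultiVector E (k + 1)) : Prop :=
  ∀ A ⊆ M, MeasurableSet A → Bornology.IsBounded A →
    (μHE[k + 1] : MeasureTheory.Measure E) A < ⊤ →
    ∀ T : Current E (k + 1), T.HasCompactSupport → T.HasBoundaryOf A ξ →
      (μHE[k + 1] : MeasureTheory.Measure E) A ≤ T.mass

end General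

/-! ### Special Lagrangian submanifolds of `ℂⁿ` -/

/-- The special Lagrangian form `Re (e^{-iθ} dz₁ ∧ ⋯ ∧ dz_n)` of phase `θ` on `ℂⁿ`. -/
def slForm (n : ℕ) (θ : ℝ) : EuclideanSpace ℂ (Fin n) [⋀^Fin n]→L[ℝ] ℝ where
  toFun v := (Complex.exp (-(θ * Complex.I)) *
    Matrix.det (Matrix.of fun i j => v i j)).re
  map_update_add' v i x y := by
    rename_i inst
    obtain rfl : inst = instDecidableEqFin n := Subsingleton.elim _ _
    have h : ∀ z : EuclideanSpace ℂ (Fin n), (Matrix.of fun a b => Function.update v i z a b) =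
        Matrix.updateRow (Matrix.of fun a b => v a b) i (fun b => z b) := by
      intro z; ext a b
      by_cases hab : a = i
      · subst hab; simp
      · simp [hab]
    rw [h, h, h, ← Complex.add_re, ← mul_add, ← Matrix.det_updateRow_add]
    rfl
  map_update_smul' v i c x := by
    rename_i inst
    obtain rfl : inst = instDecidableEqFin n := Subsingleton.elim _ _
    have h : ∀ z : EuclideanSpace ℂ (Fin n), (Matrix.of fun a b => Function.update v i z a b) =
        Matrix.updateRow (Matrix.of fun a b => v a b) i (fun b => z b) := by
      intro z; ext a b
      by_cases hab : a = i
      · subst hab; simp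
      · simp [hab]
    rw [h, h]
    have h2 : (fun b => (c • x) b) = (c : ℂ) • (fun b => x b) := by
      ext b; simp
    rw [h2, Matrix.det_updateRow_smul, mul_left_comm, smul_eq_mul, Complex.re_ofReal_mul]
  cont := by
    refine Complex.continuous_re.comp (continuous_const.mul (Continuous.matrix_det ?_))
    refine continuous_matrix fun i j => ?_
    simp only [Matrix.of_apply]
    fun_prop
  map_eq_zero_of_eq' v i j hv hij := by
    have : Matrix.det (Matrix.of fun i j => v i j) = 0 :=
      Matrix.det_zero_of_row_eq hij (by ext b; simp [hv])
    simp [this]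

/-- `M` with orientation `ξ` is a special Lagrangian `n`-submanifold of `ℂⁿ` of phase `θ`: an
oriented `n`-submanifold with boundary on which the special Lagrangian form of phase `θ` takes the
value one on the oriented unit tangent `n`-vector. -/
def IsSLSubmanifold {n : ℕ} (θ : ℝ) (M : Set (EuclideanSpace ℂ (Fin n)))
    (ξ : EuclideanSpace ℂ (Fin n) → MultiVector (EuclideanSpace ℂ (Fin n)) n) : Prop :=
  IsSubmanifold n M ∧ IsOrientation M ξ ∧ ∀ x ∈ M, ξ x (slForm n θ) = 1

/-- The image `f_* ξ` of a field of multivectors under an affine isometry `f` of `ℂⁿ`. -/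
def pushforward {n d : ℕ}
    (f : EuclideanSpace ℂ (Fin n) ≃ᵃⁱ[ℂ] EuclideanSpace ℂ (Fin n))
    (ξ : EuclideanSpace ℂ (Fin n) → MultiVector (EuclideanSpace ℂ (Fin n)) d) :
    EuclideanSpace ℂ (Fin n) → MultiVector (EuclideanSpace ℂ (Fin n)) d :=
  fun y => (ξ (f.symm y)).map
    (f.linearIsometryEquiv.toContinuousLinearEquiv.toContinuousLinearMap.restrictScalars ℝ)

open Classical in
/-- The orientation of `S ∪ -S*`, where `S* = f(S)`: that of `S` at the points of `S`, and the
opposite of the orientation carried over by `f` at the remaining points of `S*`. -/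
def unionOrientation {n d : ℕ}
    (f : EuclideanSpace ℂ (Fin n) ≃ᵃⁱ[ℂ] EuclideanSpace ℂ (Fin n))
    (S : Set (EuclideanSpace ℂ (Fin n)))
    (ξ : EuclideanSpace ℂ (Fin n) → MultiVector (EuclideanSpace ℂ (Fin n)) d) :
    EuclideanSpace ℂ (Fin n) → MultiVector (EuclideanSpace ℂ (Fin n)) d :=
  fun y => if y ∈ S then ξ y else -pushforward f ξ y

end SpecialLagrangian

end

open SpecialLagrangian

/-!
The reflection `f` in the complex hyperplane `P` has a complex linear part of determinant `-1`, so
it changes the sign of `e^{-iθ} dz₁ ∧ ⋯ ∧ dz_n` (`slForm_reflection`). Reversing the orientation of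
`f(S)` therefore makes it special Lagrangian of the same phase (`IsSLSubmanifold.reflect`), and the
special Lagrangian form takes the value one on the union at every point. By Hadamard's inequality
the form has comass one, and having constant coefficients it is exact, so the union is
area-minimizing by the calibration argument (`isAreaMinimizing_of_calibrated`). This part needs
nothing about the way in which the two pieces meet.

The smooth fit across `L` is a local matter. At a point of `L` the tangent plane of `S` is isotropic
for the Kähler form and contains the tangent directions of `L`, which span `P` over the complex
numbers; so the conormal of `S` is orthogonal to `P` (`exists_adapted_frame`). In the unitary frame
made of the boundary directions and the conormal, `S` is a graph `b = g(a)` over the half space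
`{t ≥ 0}`, where `t` is the last coordinate of `a`, and `f` changes the signs of the last
coordinates of `a` and of `b` (`exists_local_graph`). That the graph is special Lagrangian means
that `Dg` is symmetric and `Im det (1 + i Dg) = 0`. The symmetry gives `∂_t g_j = ∂_j g_t` for
`j ≠ t`, and the determinant is affine in the remaining entry `∂_t g_t` with nonzero coefficient
near the point; hence the equation takes the form `∂_t g = N(D'g)` with `D'` the tangential
derivative (`IsSLDerivative.apply_last`).

The reflected copy solves the same equation on `{t ≤ 0}`, and has the same values on `{t = 0}`
because `g_t` vanishes there. A Cauchy problem of this form determines all derivatives along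
`{t = 0}` from these values (`vanishesOn_sub_of_evolution`), so `g` and its reflected copy have the
same jets and fit together to a smooth function (`contDiffOn_glue`). No regularity theory for
elliptic equations is involved, as `S` is smooth up to its boundary. The orientations of the
two pieces agree where their tangent planes coincide, since both are calibrated
(`orientation_eq_of_mem_inter`).
-/

noncomputable section

namespace SpecialLagrangian

/-! ### Hadamard's inequality and special Lagrangian planes -/

/-- The inequality of arithmetic and geometric means for numbers of mean one, with the equality
case, from `x ≤ exp (x - 1)`. -/
theorem prod_le_one_of_sum_eq_card {ι : Type*} [Fintype ι] (a : ι → ℝ) (h0 : ∀ i, 0 ≤ a i)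
    (hs : ∑ i, a i = Fintype.card ι) :
    ∏ i, a i ≤ 1 ∧ (∏ i, a i = 1 → ∀ i, a i = 1) := by
  have hexp : ∏ i, Real.exp (a i - 1) = 1 := by
    rw [← Real.exp_sum, Finset.sum_sub_distrib, hs]
    simp
  have hle : ∀ i, a i ≤ Real.exp (a i - 1) := fun i => by
    have := Real.add_one_le_exp (a i - 1)
    linarith
  refine ⟨hexp ▸ Finset.prod_le_prod (fun i _ => h0 i) (fun i _ => hle i), fun h1 i => ?_⟩
  by_contra hi
  have hpos : ∀ j ∈ Finset.univ, 0 < a j := fun j hj => by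
    refine lt_of_le_of_ne (h0 j) fun h => ?_
    rw [Finset.prod_eq_zero hj h.symm] at h1
    exact zero_ne_one h1
  have hlt : a i < Real.exp (a i - 1) := by
    have := Real.add_one_lt_exp (sub_ne_zero.2 hi)
    linarith
  have := Finset.prod_lt_prod hpos (fun j _ => hle j) ⟨i, Finset.mem_univ i, hlt⟩
  rw [hexp, h1] at this
  exact lt_irrefl _ this

open scoped ComplexOrder in
/-- Hadamard's inequality for complex matrices whose rows are unit vectors, with the equality case:
the Gram matrix has trace `n`, so its determinant is at most one, with equality only for the
identity. -/
theorem norm_det_le_one {n : ℕ} (v : Fin n → EuclideanSpace ℂ (Fin n)) (hv : ∀ i, ‖v i‖ = 1) :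
    ‖Matrix.det (Matrix.of fun i j => v i j)‖ ≤ 1 ∧
      (‖Matrix.det (Matrix.of fun i j => v i j)‖ = 1 → Orthonormal ℂ v) := by
  set M : Matrix (Fin n) (Fin n) ℂ := Matrix.of fun i j => v i j with hM
  have hG := Matrix.posSemidef_self_mul_conjTranspose M
  have hent : ∀ i j, (M * M.conjTranspose) i j = inner ℂ (v j) (v i) := fun i j => by
    simp [Matrix.mul_apply, hM, PiLp.inner_apply]
  have hdet : (M * M.conjTranspose).det = ((‖M.det‖ ^ 2 : ℝ) : ℂ) := by
    rw [Matrix.det_mul, Matrix.det_conjTranspose, Complex.star_def, Complex.mul_conj']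
    push_cast
    ring
  have hprod : ∏ i, hG.isHermitian.eigenvalues i = ‖M.det‖ ^ 2 := by
    have := hG.isHermitian.det_eq_prod_eigenvalues
    rw [hdet] at this
    exact Complex.ofReal_injective (by rw [Complex.ofReal_prod]; exact this.symm)
  have hsum : ∑ i, hG.isHermitian.eigenvalues i = Fintype.card (Fin n) := by
    have := hG.isHermitian.trace_eq_sum_eigenvalues
    have h2 : (M * M.conjTranspose).trace = (n : ℂ) := by
      simp [Matrix.trace, hent, inner_self_eq_norm_sq_to_K, hv]
    rw [h2] at this
    rw [Fintype.card_fin]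
    refine Complex.ofReal_injective ?_
    rw [Complex.ofReal_sum, Complex.ofReal_natCast]
    exact this.symm
  have key := prod_le_one_of_sum_eq_card _ hG.eigenvalues_nonneg hsum
  rw [hprod] at key
  refine ⟨by nlinarith [key.1, norm_nonneg M.det], fun h1 => ?_⟩
  have h2 := key.2 (by rw [h1]; norm_num)
  have h3 : M * M.conjTranspose = 1 := by
    rw [hG.isHermitian.spectral_theorem]
    have : Matrix.diagonal (RCLike.ofReal ∘ hG.isHermitian.eigenvalues) =
        (1 : Matrix (Fin n) (Fin n) ℂ) := by
      rw [← Matrix.diagonal_one]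
      congr 1
      ext i
      simp [h2 i]
    rw [this, map_one]
  refine ⟨hv, fun i j hij => ?_⟩
  exact (hent j i).symm.trans (by rw [h3, Matrix.one_apply_ne hij.symm])

theorem slForm_apply {n : ℕ} (θ : ℝ) (v : Fin n → EuclideanSpace ℂ (Fin n)) :
    slForm n θ v = (Complex.exp (-(θ * Complex.I)) *
      Matrix.det (Matrix.of fun i j => v i j)).re := rfl

theorem norm_phase (θ : ℝ) : ‖Complex.exp (-(θ * Complex.I))‖ = 1 := by
  have := Complex.norm_exp_ofReal_mul_I (-θ)
  push_cast at this
  rwa [neg_mul] at this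

/-- The special Lagrangian form has comass at most one. -/
theorem abs_slForm_le_one {n : ℕ} (θ : ℝ) (v : Fin n → EuclideanSpace ℂ (Fin n))
    (hv : Orthonormal ℝ v) : |slForm n θ v| ≤ 1 := by
  rw [slForm_apply]
  refine (Complex.abs_re_le_norm _).trans ?_
  rw [norm_mul, norm_phase, one_mul]
  exact (norm_det_le_one v hv.1).1

/-- Orthonormal frames on which the special Lagrangian form takes its maximal value one are
unitary, and their complex determinant has phase exactly `θ`. -/
theorem calibrated_frame {n : ℕ} {θ : ℝ} {v : Fin n → EuclideanSpace ℂ (Fin n)}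
    (hv : Orthonormal ℝ v) (h1 : slForm n θ v = 1) :
    Orthonormal ℂ v ∧
      Complex.exp (-(θ * Complex.I)) * Matrix.det (Matrix.of fun i j => v i j) = 1 := by
  have hle := (norm_det_le_one v hv.1).1
  rw [slForm_apply] at h1
  set z := Complex.exp (-(θ * Complex.I)) * Matrix.det (Matrix.of fun i j => v i j) with hz
  have hnz : ‖z‖ = ‖Matrix.det (Matrix.of fun i j => v i j)‖ := by
    rw [hz, norm_mul, norm_phase, one_mul]
  have h2 : ‖z‖ = 1 := le_antisymm (hnz ▸ hle) (h1 ▸ Complex.re_le_norm z)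
  refine ⟨(norm_det_le_one v hv.1).2 (hnz ▸ h2), ?_⟩
  have h3 : ‖z‖ ^ 2 = z.re ^ 2 + z.im ^ 2 := by
    rw [← Complex.normSq_eq_norm_sq, Complex.normSq_apply]; ring
  rw [h2, h1] at h3
  exact Complex.ext h1 (by simpa using h3)

/-- A special Lagrangian plane is isotropic for the Kähler form, and the imaginary part of
`e^{-iθ} dz₁ ∧ ⋯ ∧ dz_n` vanishes on it. -/
theorem calibrated_span {n : ℕ} {θ : ℝ} {v : Fin n → EuclideanSpace ℂ (Fin n)}
    (hv : Orthonormal ℝ v) (h1 : slForm n θ v = 1) :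
    (∀ u ∈ Submodule.span ℝ (Set.range v), ∀ w ∈ Submodule.span ℝ (Set.range v),
      (inner ℂ u w).im = 0) ∧
    ∀ u : Fin n → EuclideanSpace ℂ (Fin n), (∀ i, u i ∈ Submodule.span ℝ (Set.range v)) →
      (Complex.exp (-(θ * Complex.I)) * Matrix.det (Matrix.of fun i j => u i j)).im = 0 := by
  obtain ⟨ho, hd⟩ := calibrated_frame hv h1
  constructor
  · intro u hu w hw
    obtain ⟨a, rfl⟩ := (Submodule.mem_span_range_iff_exists_fun ℝ).1 hu
    obtain ⟨b, rfl⟩ := (Submodule.mem_span_range_iff_exists_fun ℝ).1 hw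
    have : ∀ c : Fin n → ℝ, ∑ i, c i • v i = ∑ i, (c i : ℂ) • v i := fun c => by
      simp [Complex.coe_smul]
    rw [this, this, ho.inner_sum]
    simp only [Complex.conj_ofReal, ← Complex.ofReal_mul, ← Complex.ofReal_sum,
      Complex.ofReal_im]
  · intro u hu
    choose a ha using fun i => (Submodule.mem_span_range_iff_exists_fun ℝ).1 (hu i)
    have hmul : (Matrix.of fun i j => u i j) =
        ((Matrix.of a).map Complex.ofRealHom) * (Matrix.of fun i j => v i j) := by
      ext i j
      simp [Matrix.mul_apply, ← ha i]
    rw [hmul, Matrix.det_mul, mul_left_comm, hd, mul_one, ← RingHom.mapMatrix_apply,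
      ← RingHom.map_det]
    simp

/-! ### Simple multivectors -/

section Wedge

variable {E : Type*} [NormedAddCommGroup E] [InnerProductSpace ℝ E]

theorem wedge_apply {d : ℕ} (v : Fin d → E) (α : E [⋀^Fin d]→L[ℝ] ℝ) : wedge v α = α v := rfl

theorem neg_wedge {d : ℕ} (v : Fin (d + 1) → E) :
    -wedge v = wedge (Function.update v 0 (-v 0)) := by
  ext α
  have := α.toAlternatingMap.map_update_neg v 0 (v 0)
  rw [Function.update_eq_self] at this
  exact this.symm

theorem orthonormal_update_neg {d : ℕ} {v : Fin (d + 1) → E} (hv : Orthonormal ℝ v) :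
    Orthonormal ℝ (Function.update v 0 (-v 0)) := by
  constructor
  · intro i
    by_cases hi : i = 0
    · subst hi; simpa using hv.1 0
    · simpa [hi] using hv.1 i
  · intro i j hij
    have := hv.2 hij
    by_cases hi : i = 0
    · subst hi
      simpa [hij.symm, Function.update_of_ne hij.symm] using this
    · by_cases hj : j = 0
      · subst hj
        simpa [hi] using this
      · simpa [hi, hj] using this

theorem span_update_neg {d : ℕ} (v : Fin (d + 1) → E) :
    Submodule.span ℝ (Set.range (Function.update v 0 (-v 0))) =
      Submodule.span ℝ (Set.range v) := by
  have aux : ∀ w : Fin (d + 1) → E, Submodule.span ℝ (Set.range (Function.update w 0 (-w 0))) ≤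
      Submodule.span ℝ (Set.range w) := by
    intro w
    rw [Submodule.span_le]
    rintro _ ⟨i, rfl⟩
    by_cases hi : i = 0
    · subst hi
      simpa using Submodule.subset_span (Set.mem_range_self _)
    · simpa [hi] using Submodule.subset_span (Set.mem_range_self _)
  refine le_antisymm (aux v) ?_
  simpa using aux (Function.update v 0 (-v 0))

/-- Two simple multivectors with the same span are proportional, so they agree as soon as some
alternating form takes the same nonzero value on both. -/
theorem wedge_eq_of_span_eq {d : ℕ} {v w : Fin d → E} (hv : Orthonormal ℝ v)
    (hs : Submodule.span ℝ (Set.range v) = Submodule.span ℝ (Set.range w))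
    {φ : E [⋀^Fin d]→L[ℝ] ℝ} (h : φ v = φ w) (h0 : φ v ≠ 0) : wedge v = wedge w := by
  let b := Module.Basis.span hv.linearIndependent
  have hb : ∀ i, ((b i : Submodule.span ℝ (Set.range v)) : E) = v i := fun i =>
    congrArg Subtype.val (Module.Basis.span_apply hv.linearIndependent i)
  have hw : ∀ i, w i ∈ Submodule.span ℝ (Set.range v) := fun i =>
    hs ▸ Submodule.subset_span (Set.mem_range_self i)
  let w' : Fin d → Submodule.span ℝ (Set.range v) := fun i => ⟨w i, hw i⟩
  have key : ∀ α : E [⋀^Fin d]→L[ℝ] ℝ, α w = α v * b.det w' := by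
    intro α
    have := congrArg (fun F => F w') (AlternatingMap.eq_smul_basis_det b
      (α.toAlternatingMap.compLinearMap (Submodule.subtype _)))
    simpa [hb, w', Function.comp_def] using this
  have h1 : b.det w' = 1 := by
    have := key φ
    rw [← h] at this
    exact (mul_right_eq_self₀.1 this.symm).resolve_right h0
  ext α
  rw [wedge_apply, wedge_apply, key α, h1, mul_one]

end Wedge

/-! ### The calibration argument -/

section Calibration

variable {E : Type*} [NormedAddCommGroup E] [InnerProductSpace ℝ E] [FiniteDimensional ℝ E]
variable [MeasurableSpace E] [BorelSpace E]

/-- The fundamental theorem of calibrations for a constant coefficient form `φ`. Such a form is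
exact, `φ = dη` with `η` linear; cutting `η` off outside a large ball gives a test form whose
derivative is `φ` near `A` and near the support of the competitor. -/
theorem isAreaMinimizing_of_calibrated {k : ℕ} (φ : E [⋀^Fin (k + 1)]→L[ℝ] ℝ)
    (hφ : ∀ v : Fin (k + 1) → E, Orthonormal ℝ v → |φ v| ≤ 1) (M : Set E)
    (ξ : E → MultiVector E (k + 1)) (hM : ∀ x ∈ M, ξ x φ = 1) : IsAreaMinimizing M ξ := by
  intro A hAM hAm hAb hAfin T hT hTA
  obtain ⟨K, hK, hTK⟩ := hT
  obtain ⟨R, hR⟩ := (hAb.union hK.isBounded).subset_closedBall (0 : E)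
  let R' := max R 0 + 1
  have hR' : 0 < R' := by positivity
  let χ : ContDiffBump (0 : E) := ⟨R', R' + 1, hR', by linarith⟩
  have hχ1 : ∀ x ∈ Metric.ball (0 : E) R', χ x = 1 := fun x hx =>
    χ.one_of_mem_closedBall (Metric.ball_subset_closedBall hx)
  have hAK : A ∪ K ⊆ Metric.ball (0 : E) R' := fun x hx => by
    have := hR hx
    rw [Metric.mem_closedBall] at this
    rw [Metric.mem_ball]
    exact lt_of_le_of_lt (this.trans (le_max_left R 0)) (lt_add_one _)
  let ι : E →L[ℝ] E [⋀^Fin k]→L[ℝ] ℝ := ((k + 1 : ℕ) : ℝ)⁻¹ • φ.curryLeft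
  let η₀ : E → E [⋀^Fin k]→L[ℝ] ℝ := fun x => χ x • ι x
  have hη₀ : ContDiff ℝ ∞ η₀ := χ.contDiff.smul ι.contDiff
  have hη₀c : HasCompactSupport η₀ := χ.hasCompactSupport.smul_right
  let α₀ : E → E [⋀^Fin (k + 1)]→L[ℝ] ℝ := extDeriv η₀
  have hα₀ : ContDiff ℝ ∞ α₀ := by
    have h1 : ContDiff ℝ ∞ (fderiv ℝ η₀) := hη₀.fderiv_right (by simp)
    exact (ContinuousAlternatingMap.alternatizeUncurryFinCLM ℝ E ℝ).contDiff.comp h1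
  have hα₀c : HasCompactSupport α₀ := by
    have := hη₀c.fderiv (𝕜 := ℝ)
    exact this.comp_left
      (g := ContinuousAlternatingMap.alternatizeUncurryFinCLM ℝ E ℝ) (map_zero _)
  have hα₀φ : ∀ x ∈ Metric.ball (0 : E) R', α₀ x = φ := by
    intro x hx
    have hev : η₀ =ᶠ[nhds x] ι := by
      filter_upwards [Metric.isOpen_ball.mem_nhds hx] with y hy
      simp [η₀, hχ1 y hy]
    have : α₀ x = extDeriv ι x := hev.extDeriv_eq
    rw [this, extDeriv, ContinuousLinearMap.fderiv]
    simp only [ι]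
    rw [ContinuousAlternatingMap.alternatizeUncurryFin_smul,
      ContinuousAlternatingMap.alternatizeUncurryFin_curryLeft, ← Nat.cast_smul_eq_nsmul ℝ,
      smul_smul, inv_mul_cancel₀ (by positivity), one_smul]
  let η : TestForm E k := ⟨η₀, hη₀, hη₀c, fun _ _ => trivial⟩
  let α : TestForm E (k + 1) := ⟨α₀, hα₀, hα₀c, fun _ _ => trivial⟩
  let β : TestForm E (k + 1) := ⟨fun x => χ x • φ, χ.contDiff.smul contDiff_const,
    χ.hasCompactSupport.smul_right, fun _ _ => trivial⟩
  have hTα : T α = integrate A ξ α := hTA η α fun x => rfl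
  have hint : integrate A ξ α = ((μHE[k + 1] : MeasureTheory.Measure E) A).toReal := by
    have : ∀ x ∈ A, ξ x (α x) = 1 := fun x hx => by
      have : α x = φ := hα₀φ x (hAK (Or.inl hx))
      rw [this, hM x (hAM hx)]
    rw [integrate, MeasureTheory.setIntegral_congr_fun hAm this]
    simp [MeasureTheory.Measure.real]
  have hTβ : T β = T α := by
    rw [← sub_eq_zero, ← map_sub]
    refine hTK _ ?_
    rw [Set.disjoint_right]
    intro x hxK hx
    refine notMem_tsupport_iff_eventuallyEq.2 ?_ hx
    filter_upwards [Metric.isOpen_ball.mem_nhds (hAK (Or.inr hxK))] with y hy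
    have h1 : α y = φ := hα₀φ y hy
    have h2 : β y = χ y • φ := rfl
    have h3 : (β - α) y = β y - α y := rfl
    rw [h3, h1, h2, hχ1 y hy]
    simp
  have hβ : ∀ (x : E) (v : Fin (k + 1) → E), Orthonormal ℝ v → |β x v| ≤ 1 := by
    intro x v hv
    have : β x v = χ x * φ v := rfl
    rw [this, abs_mul, abs_of_nonneg χ.nonneg]
    exact mul_le_one₀ χ.le_one (abs_nonneg _) (hφ v hv)
  have : ENNReal.ofReal (T β) ≤ T.mass := le_iSup₂_of_le β hβ le_rfl
  rwa [hTβ, hTα, hint, ENNReal.ofReal_toReal hAfin.ne] at this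

end Calibration

/-! ### Jets along a hyperplane -/

section Jets

universe u
variable {X : Type u} [NormedAddCommGroup X] [NormedSpace ℝ X]

/-- All derivatives of `w` of order less than `k` vanish at the points of `Z`. The recursion over
the order passes to the derivative, which takes values in another space. -/
def VanishesOn (Z : Set X) : ℕ → ∀ {F : Type u} [NormedAddCommGroup F] [NormedSpace ℝ F],
    (X → F) → Prop
  | 0, _, _, _, _ => True
  | k + 1, _, _, _, w => (∀ p ∈ Z, w p = 0) ∧ VanishesOn Z k (fderiv ℝ w)

variable {F G : Type u} [NormedAddCommGroup F] [NormedSpace ℝ F] [NormedAddCommGroup G]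
  [NormedSpace ℝ G] {Z Ω : Set X}

theorem contDiffOn_fderiv (hΩ : IsOpen Ω) {w : X → F} (hw : ContDiffOn ℝ ∞ w Ω) :
    ContDiffOn ℝ ∞ (fderiv ℝ w) Ω :=
  hw.fderiv_of_isOpen hΩ (by simp)

theorem differentiableAt_of_contDiffOn (hΩ : IsOpen Ω) {w : X → F} (hw : ContDiffOn ℝ ∞ w Ω)
    {p : X} (hp : p ∈ Ω) : DifferentiableAt ℝ w p :=
  (hw.contDiffAt (hΩ.mem_nhds hp)).differentiableAt (by simp)

theorem VanishesOn.congr (hΩ : IsOpen Ω) (hZ : Z ⊆ Ω) {k : ℕ} {w w' : X → F}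
    (h : VanishesOn Z k w) (hww : Set.EqOn w w' Ω) : VanishesOn Z k w' := by
  induction k generalizing F with
  | zero => trivial
  | succ k ih =>
    refine ⟨fun p hp => by rw [← hww (hZ hp), h.1 p hp], ih h.2 fun p hp => ?_⟩
    exact (hww.eventuallyEq_of_mem (hΩ.mem_nhds hp)).fderiv_eq

theorem VanishesOn.of_succ {k : ℕ} {w : X → F} (h : VanishesOn Z (k + 1) w) :
    VanishesOn Z k w := by
  induction k generalizing F with
  | zero => trivial
  | succ k ih => exact ⟨h.1, ih h.2⟩

theorem VanishesOn.clm_comp (hΩ : IsOpen Ω) (hZ : Z ⊆ Ω) {k : ℕ} {w : X → F}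
    (hw : ContDiffOn ℝ ∞ w Ω) (h : VanishesOn Z k w) (A : F →L[ℝ] G) :
    VanishesOn Z k (fun y => A (w y)) := by
  induction k generalizing F G with
  | zero => trivial
  | succ k ih =>
    refine ⟨fun p hp => by beta_reduce; rw [h.1 p hp, map_zero], ?_⟩
    refine (ih (contDiffOn_fderiv hΩ hw) h.2 (ContinuousLinearMap.compL ℝ X F G A)).congr hΩ hZ
      fun p hp => ?_
    exact ((A.hasFDerivAt.comp p (differentiableAt_of_contDiffOn hΩ hw hp).hasFDerivAt).fderiv).symm

theorem VanishesOn.add (hΩ : IsOpen Ω) (hZ : Z ⊆ Ω) {k : ℕ} {v w : X → F}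
    (hv : ContDiffOn ℝ ∞ v Ω) (hw : ContDiffOn ℝ ∞ w Ω)
    (h : VanishesOn Z k v) (h' : VanishesOn Z k w) : VanishesOn Z k (fun y => v y + w y) := by
  induction k generalizing F with
  | zero => trivial
  | succ k ih =>
    refine ⟨fun p hp => by beta_reduce; rw [h.1 p hp, h'.1 p hp, add_zero], ?_⟩
    refine (ih (contDiffOn_fderiv hΩ hv) (contDiffOn_fderiv hΩ hw) h.2 h'.2).congr hΩ hZ
      fun p hp => ?_
    exact (fderiv_fun_add (differentiableAt_of_contDiffOn hΩ hv hp)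
      (differentiableAt_of_contDiffOn hΩ hw hp)).symm

theorem VanishesOn.sub (hΩ : IsOpen Ω) (hZ : Z ⊆ Ω) {k : ℕ} {v w : X → F}
    (hv : ContDiffOn ℝ ∞ v Ω) (hw : ContDiffOn ℝ ∞ w Ω)
    (h : VanishesOn Z k v) (h' : VanishesOn Z k w) : VanishesOn Z k (fun y => v y - w y) :=
  (h.add hΩ hZ hv hw.neg (h'.clm_comp hΩ hZ hw (-ContinuousLinearMap.id ℝ F))).congr hΩ hZ
    fun p _ => by simp [sub_eq_add_neg]

theorem VanishesOn.prodMk (hΩ : IsOpen Ω) (hZ : Z ⊆ Ω) {k : ℕ} {v : X → F} {w : X → G}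
    (hv : ContDiffOn ℝ ∞ v Ω) (hw : ContDiffOn ℝ ∞ w Ω)
    (h : VanishesOn Z k v) (h' : VanishesOn Z k w) : VanishesOn Z k (fun y => (v y, w y)) := by
  refine ((h.clm_comp hΩ hZ hv (ContinuousLinearMap.inl ℝ F G)).add hΩ hZ
    ((ContinuousLinearMap.inl ℝ F G).contDiff.comp_contDiffOn hv)
    ((ContinuousLinearMap.inr ℝ F G).contDiff.comp_contDiffOn hw)
    (h'.clm_comp hΩ hZ hw (ContinuousLinearMap.inr ℝ F G))).congr hΩ hZ fun p _ => ?_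
  simp

/-- If the jets of `a` and `b` agree, then so do those of `N ∘ a` and `N ∘ b`. The chain rule
writes the derivative of `N ∘ a` as a smooth function of the pair `(a, Da)`. -/
theorem VanishesOn.comp_sub_comp (hΩ : IsOpen Ω) (hZ : Z ⊆ Ω) {k : ℕ} {O : Set F} (hO : IsOpen O)
    {N : F → G} (hN : ContDiffOn ℝ ∞ N O) {a b : X → F} (ha : ContDiffOn ℝ ∞ a Ω)
    (hb : ContDiffOn ℝ ∞ b Ω) (haO : Set.MapsTo a Ω O) (hbO : Set.MapsTo b Ω O)
    (h : VanishesOn Z k (fun y => a y - b y)) :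
    VanishesOn Z k (fun y => N (a y) - N (b y)) := by
  induction k generalizing F G with
  | zero => trivial
  | succ k ih =>
    refine ⟨fun p hp => by beta_reduce; rw [sub_eq_zero.1 (h.1 p hp), sub_self], ?_⟩
    have hN' : ContDiffOn ℝ ∞ (fderiv ℝ N) O := hN.fderiv_of_isOpen hO (by simp)
    let N₂ : F × (X →L[ℝ] F) → (X →L[ℝ] G) := fun q => (fderiv ℝ N q.1).comp q.2
    have hN₂ : ContDiffOn ℝ ∞ N₂ (O ×ˢ Set.univ) :=
      (hN'.comp contDiffOn_fst fun q hq => hq.1).clm_comp contDiffOn_snd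
    have hpair : VanishesOn Z k fun y => (a y, fderiv ℝ a y) - (b y, fderiv ℝ b y) := by
      refine VanishesOn.prodMk hΩ hZ (ha.sub hb)
        ((contDiffOn_fderiv hΩ ha).sub (contDiffOn_fderiv hΩ hb)) h.of_succ ?_
      refine h.2.congr hΩ hZ fun p hp => ?_
      exact fderiv_fun_sub (differentiableAt_of_contDiffOn hΩ ha hp)
        (differentiableAt_of_contDiffOn hΩ hb hp)
    refine (ih (hO.prod isOpen_univ) hN₂ (ha.prodMk (contDiffOn_fderiv hΩ ha))
      (hb.prodMk (contDiffOn_fderiv hΩ hb)) (fun p hp => ⟨haO hp, trivial⟩)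
      (fun p hp => ⟨hbO hp, trivial⟩) hpair).congr hΩ hZ fun p hp => ?_
    have hNa := differentiableAt_of_contDiffOn hO hN (haO hp)
    have hNb := differentiableAt_of_contDiffOn hO hN (hbO hp)
    exact ((hNa.hasFDerivAt.comp p (differentiableAt_of_contDiffOn hΩ ha hp).hasFDerivAt).sub
      (hNb.hasFDerivAt.comp p
        (differentiableAt_of_contDiffOn hΩ hb hp).hasFDerivAt)).fderiv.symm

/-- Derivatives in directions tangential to `Z` do not lower the order of vanishing along `Z`. -/
theorem VanishesOn.fderiv_comp (hΩ : IsOpen Ω) (hZ : Z ⊆ Ω) {π : X →L[ℝ] X}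
    (hπ : ∀ p ∈ Z, ∀ v, ∀ᶠ s : ℝ in nhds 0, p + s • π v ∈ Z) {k : ℕ} {w : X → F}
    (hw : ContDiffOn ℝ ∞ w Ω) (h : VanishesOn Z k w) :
    VanishesOn Z k (fun y => (fderiv ℝ w y).comp π) := by
  induction k generalizing F with
  | zero => trivial
  | succ k ih =>
    constructor
    · intro p hp
      ext v
      have hd : HasFDerivAt w (fderiv ℝ w p) (p + (0 : ℝ) • π v) := by
        rw [zero_smul, add_zero]
        exact (differentiableAt_of_contDiffOn hΩ hw (hZ hp)).hasFDerivAt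
      have hline : HasDerivAt (fun s : ℝ => p + s • π v) (π v) 0 := by
        simpa using ((hasDerivAt_id (0 : ℝ)).smul_const (π v)).const_add p
      have h1 := hd.comp_hasDerivAt (0 : ℝ) hline
      have h2 : (w ∘ fun s : ℝ => p + s • π v) =ᶠ[nhds 0] fun _ => 0 := by
        filter_upwards [hπ p hp v] with s hs using h.1 _ hs
      simpa using (h1.congr_of_eventuallyEq h2.symm).unique (hasDerivAt_const (0 : ℝ) (0 : F))
    · have hw' := contDiffOn_fderiv hΩ hw
      have hw'' : ContDiffOn ℝ ∞ (fun y => (fderiv ℝ (fderiv ℝ w) y).comp π) Ω :=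
        (contDiffOn_fderiv hΩ hw').clm_comp contDiffOn_const
      refine ((ih hw' h.2).clm_comp hΩ hZ hw''
        (ContinuousLinearMap.flipₗᵢ ℝ X X F).toContinuousLinearEquiv.toContinuousLinearMap).congr
        hΩ hZ fun p hp => ?_
      have hsymm : IsSymmSndFDerivAt ℝ w p :=
        (hw.contDiffAt (hΩ.mem_nhds hp)).isSymmSndFDerivAt
          (by
            rw [minSmoothness_of_isRCLikeNormedField]
            exact WithTop.coe_le_coe.2 (le_top : (2 : ℕ∞) ≤ ⊤))
      have hd : HasFDerivAt (fun y => (fderiv ℝ w y).comp π)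
          (((ContinuousLinearMap.compL ℝ X X F).flip π).comp (fderiv ℝ (fderiv ℝ w) p)) p :=
        ((ContinuousLinearMap.compL ℝ X X F).flip π).hasFDerivAt.comp p
          (differentiableAt_of_contDiffOn hΩ hw' hp).hasFDerivAt
      rw [hd.fderiv]
      ext u v
      exact hsymm.eq (π v) u

/-- A function vanishing on `Z` gains one order of vanishing if its tangential derivatives and one
transversal derivative vanish to order `k`. -/
theorem VanishesOn.succ_of_fderiv (hΩ : IsOpen Ω) (hZ : Z ⊆ Ω) {π : X →L[ℝ] X} {t : X →L[ℝ] ℝ}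
    {ν : X} (hid : ∀ v, v = π v + t v • ν) {k : ℕ} {w : X → F} (hw : ContDiffOn ℝ ∞ w Ω)
    (h0 : ∀ p ∈ Z, w p = 0) (h1 : VanishesOn Z k (fun y => (fderiv ℝ w y).comp π))
    (h2 : VanishesOn Z k (fun y => fderiv ℝ w y ν)) : VanishesOn Z (k + 1) w := by
  have hw' := contDiffOn_fderiv hΩ hw
  have hwν : ContDiffOn ℝ ∞ (fun y => fderiv ℝ w y ν) Ω := hw'.clm_apply contDiffOn_const
  refine ⟨h0, (h1.add hΩ hZ (hw'.clm_comp contDiffOn_const)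
    ((ContinuousLinearMap.smulRightL ℝ X F t).contDiff.comp_contDiffOn hwν)
    (h2.clm_comp hΩ hZ hwν (ContinuousLinearMap.smulRightL ℝ X F t))).congr hΩ hZ fun p _ => ?_⟩
  ext v
  conv_rhs => rw [hid v, map_add, map_smul]
  simp

/-- A smooth function that vanishes on an open set vanishes to infinite order on its closure. -/
theorem vanishesOn_of_eqOn_zero (hΩ : IsOpen Ω) (hZ : Z ⊆ Ω) {s : Set X} (hs : IsOpen s)
    (hZs : Z ⊆ closure s) {w : X → F} (hw : ContDiffOn ℝ ∞ w Ω) (h0 : ∀ p ∈ s, w p = 0) (k : ℕ) :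
    VanishesOn Z k w := by
  induction k generalizing F with
  | zero => trivial
  | succ k ih =>
    refine ⟨fun p hp => ?_, ih (contDiffOn_fderiv hΩ hw) fun p hp => ?_⟩
    · have hc : ContinuousAt w p := (hw.continuousOn).continuousAt (hΩ.mem_nhds (hZ hp))
      have hcl := mem_closure_image hc (hZs hp)
      have : w '' s ⊆ {0} := by
        rintro _ ⟨q, hq, rfl⟩
        exact h0 q hq
      simpa using closure_mono this hcl
    · have : w =ᶠ[nhds p] fun _ => 0 := by
        filter_upwards [hs.mem_nhds hp] with q hq using h0 q hq
      rw [this.fderiv_eq]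
      simp

open Classical in
/-- The function equal to `g` on the half space `{0 ≤ t}` and to `h` on the other one. -/
def glue (t : X →L[ℝ] ℝ) (g h : X → F) : X → F := fun y => if 0 ≤ t y then g y else h y

/-- Functions that agree to first order along the hyperplane fit together to a differentiable
function, whose derivative is obtained by gluing the two derivatives. This allows for induction on
the order of differentiability. -/
theorem hasFDerivAt_glue (hΩ : IsOpen Ω) {t : X →L[ℝ] ℝ} {g h : X → F}
    (hg : ContDiffOn ℝ ∞ g Ω) (hh : ContDiffOn ℝ ∞ h Ω)
    (hv : VanishesOn (Ω ∩ {y | t y = 0}) 2 (fun y => g y - h y)) {p : X} (hp : p ∈ Ω) :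
    HasFDerivAt (glue t g h) (glue t (fderiv ℝ g) (fderiv ℝ h) p) p := by
  have hgd := (differentiableAt_of_contDiffOn hΩ hg hp).hasFDerivAt
  have hhd := (differentiableAt_of_contDiffOn hΩ hh hp).hasFDerivAt
  rcases lt_trichotomy (t p) 0 with hlt | heq | hgt
  · rw [glue, if_neg hlt.not_ge]
    refine hhd.congr_of_eventuallyEq ?_
    filter_upwards [(isOpen_lt t.continuous continuous_const).mem_nhds hlt] with q hq
    exact if_neg (not_le.2 hq)
  · have hfd : fderiv ℝ g p = fderiv ℝ h p := by
      have h1 := hv.2.1 p ⟨hp, heq⟩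
      rw [fderiv_fun_sub (differentiableAt_of_contDiffOn hΩ hg hp)
        (differentiableAt_of_contDiffOn hΩ hh hp)] at h1
      exact sub_eq_zero.1 h1
    have hgh : g p = h p := sub_eq_zero.1 (hv.1 p ⟨hp, heq⟩)
    have hder : glue t (fderiv ℝ g) (fderiv ℝ h) p = fderiv ℝ g p := if_pos heq.ge
    have hval : glue t g h p = g p := if_pos heq.ge
    rw [hder]
    have h1 : HasFDerivWithinAt (glue t g h) (fderiv ℝ g p) {q | 0 ≤ t q} p :=
      hgd.hasFDerivWithinAt.congr (fun q hq => if_pos hq) hval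
    have h2 : HasFDerivWithinAt (glue t g h) (fderiv ℝ g p) {q | t q < 0} p :=
      (hfd ▸ hhd).hasFDerivWithinAt.congr (fun q hq => if_neg (not_le.2 hq)) (hval.trans hgh)
    have h3 := h1.union h2
    have hun : {q | 0 ≤ t q} ∪ {q | t q < 0} = Set.univ := by
      ext q
      simpa using le_or_gt 0 (t q)
    rwa [hun, hasFDerivWithinAt_univ] at h3
  · rw [glue, if_pos hgt.le]
    refine hgd.congr_of_eventuallyEq ?_
    filter_upwards [(isOpen_lt continuous_const t.continuous).mem_nhds hgt] with q hq
    exact if_pos (le_of_lt hq)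

/-- Two smooth functions whose jets agree along a hyperplane fit together to a smooth function. -/
theorem contDiffOn_glue (hΩ : IsOpen Ω) {t : X →L[ℝ] ℝ} {g h : X → F}
    (hg : ContDiffOn ℝ ∞ g Ω) (hh : ContDiffOn ℝ ∞ h Ω)
    (hv : ∀ k, VanishesOn (Ω ∩ {y | t y = 0}) k (fun y => g y - h y)) :
    ContDiffOn ℝ ∞ (glue t g h) Ω := by
  rw [contDiffOn_infty]
  intro k
  have hk := hv (k + 2)
  clear hv
  induction k generalizing F with
  | zero =>
    refine contDiffOn_zero.2 fun p hp => ?_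
    exact (hasFDerivAt_glue hΩ hg hh hk hp).continuousAt.continuousWithinAt
  | succ k ih =>
    have hv2 : VanishesOn (Ω ∩ {y | t y = 0}) 2 (fun y => g y - h y) :=
      ⟨hk.1, hk.2.1, trivial⟩
    have hd := fun p (hp : p ∈ Ω) => hasFDerivAt_glue hΩ hg hh hv2 hp
    have hsub : VanishesOn (Ω ∩ {y | t y = 0}) (k + 2)
        (fun y => fderiv ℝ g y - fderiv ℝ h y) :=
      hk.2.congr hΩ Set.inter_subset_left fun p hp =>
        fderiv_fun_sub (differentiableAt_of_contDiffOn hΩ hg hp)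
          (differentiableAt_of_contDiffOn hΩ hh hp)
    rw [Nat.cast_add, Nat.cast_one, contDiffOn_succ_iff_fderiv_of_isOpen hΩ]
    refine ⟨fun p hp => (hd p hp).differentiableAt.differentiableWithinAt, by simp, ?_⟩
    exact (ih (contDiffOn_fderiv hΩ hg) (contDiffOn_fderiv hΩ hh) hsub).congr
      fun p hp => (hd p hp).fderiv

end Jets

/-! ### Uniqueness of jets for evolution equations -/

section Evolution

universe u
variable {X : Type u} [NormedAddCommGroup X] [NormedSpace ℝ X]
variable {F : Type u} [NormedAddCommGroup F] [NormedSpace ℝ F]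

/-- Formal uniqueness for the noncharacteristic Cauchy problem `∂_ν u = N(D'u)`, where `D'` is the
tangential derivative: a solution `g` on one side of the hyperplane `{t = 0}` and a solution `h` on
the other side with the same Cauchy data have the same jets along the hyperplane. -/
theorem vanishesOn_sub_of_evolution {Ω : Set X} (hΩ : IsOpen Ω) {t : X →L[ℝ] ℝ} {π : X →L[ℝ] X}
    {ν : X} (hid : ∀ v, v = π v + t v • ν) (hν : t ν = 1) (htπ : ∀ v, t (π v) = 0)
    {O : Set (X →L[ℝ] F)} (hO : IsOpen O) {N : (X →L[ℝ] F) → F} (hN : ContDiffOn ℝ ∞ N O)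
    {g h : X → F} (hg : ContDiffOn ℝ ∞ g Ω) (hh : ContDiffOn ℝ ∞ h Ω)
    (hgO : ∀ y ∈ Ω, (fderiv ℝ g y).comp π ∈ O) (hhO : ∀ y ∈ Ω, (fderiv ℝ h y).comp π ∈ O)
    (hgN : ∀ y ∈ Ω, 0 < t y → fderiv ℝ g y ν = N ((fderiv ℝ g y).comp π))
    (hhN : ∀ y ∈ Ω, t y < 0 → fderiv ℝ h y ν = N ((fderiv ℝ h y).comp π))
    (hgh : ∀ y ∈ Ω, t y = 0 → g y = h y) (k : ℕ) :
    VanishesOn (Ω ∩ {y | t y = 0}) k (fun y => g y - h y) := by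
  set Z := Ω ∩ {y | t y = 0} with hZdef
  have hZ : Z ⊆ Ω := Set.inter_subset_left
  have hgπ : ContDiffOn ℝ ∞ (fun y => (fderiv ℝ g y).comp π) Ω :=
    (contDiffOn_fderiv hΩ hg).clm_comp contDiffOn_const
  have hhπ : ContDiffOn ℝ ∞ (fun y => (fderiv ℝ h y).comp π) Ω :=
    (contDiffOn_fderiv hΩ hh).clm_comp contDiffOn_const
  have hgν : ContDiffOn ℝ ∞ (fun y => fderiv ℝ g y ν) Ω :=
    (contDiffOn_fderiv hΩ hg).clm_apply contDiffOn_const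
  have hhν : ContDiffOn ℝ ∞ (fun y => fderiv ℝ h y ν) Ω :=
    (contDiffOn_fderiv hΩ hh).clm_apply contDiffOn_const
  have hNg := hN.comp hgπ hgO
  have hNh := hN.comp hhπ hhO
  have hlim : ∀ p ∈ Z, ∀ v : X, Filter.Tendsto (fun s : ℝ => p + s • v) (nhds 0) (nhds p) := by
    intro p _ v
    have : Continuous fun s : ℝ => p + s • v := by fun_prop
    simpa using this.tendsto 0
  have hcl : ∀ c : ℝ, c ≠ 0 → Z ⊆ closure (Ω ∩ {y | 0 < c * t y}) := by
    intro c hc p hp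
    have h1 := (hlim p hp (c • ν)).mono_left (nhdsWithin_le_nhds (s := Set.Ioi (0 : ℝ)))
    refine mem_closure_of_tendsto h1 ?_
    filter_upwards [h1 (hΩ.mem_nhds hp.1), self_mem_nhdsWithin] with s hs hs0
    refine ⟨hs, ?_⟩
    have hp2 : t p = 0 := hp.2
    have : 0 < c * c := mul_self_pos.2 hc
    have hs0 : 0 < s := hs0
    simp only [Set.mem_ofPred_eq, map_add, map_smul, hp2, hν, smul_eq_mul]
    nlinarith [mul_pos this hs0]
  have hopen : ∀ c : ℝ, IsOpen (Ω ∩ {y | 0 < c * t y}) := fun c =>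
    hΩ.inter (isOpen_lt continuous_const (continuous_const.mul t.continuous))
  have hπ : ∀ p ∈ Z, ∀ v, ∀ᶠ s : ℝ in nhds 0, p + s • π v ∈ Z := by
    intro p hp v
    filter_upwards [hlim p hp (π v) (hΩ.mem_nhds hp.1)] with s hs
    refine ⟨hs, ?_⟩
    have hp2 : t p = 0 := hp.2
    simp [hp2, htπ]
  have hfd : ∀ y ∈ Ω, fderiv ℝ (fun y => g y - h y) y = fderiv ℝ g y - fderiv ℝ h y :=
    fun y hy => fderiv_fun_sub (differentiableAt_of_contDiffOn hΩ hg hy)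
      (differentiableAt_of_contDiffOn hΩ hh hy)
  induction k with
  | zero => trivial
  | succ k ih =>
    have h1 := ih.fderiv_comp hΩ hZ hπ (hg.sub hh)
    refine VanishesOn.succ_of_fderiv hΩ hZ hid (hg.sub hh)
      (fun p hp => sub_eq_zero.2 (hgh p hp.1 hp.2)) h1 ?_
    have h2 : VanishesOn Z k fun y => (fderiv ℝ g y).comp π - (fderiv ℝ h y).comp π :=
      h1.congr hΩ hZ fun y hy => by
        beta_reduce
        rw [hfd y hy, ContinuousLinearMap.sub_comp]
    have h3 := VanishesOn.comp_sub_comp hΩ hZ hO hN hgπ hhπ hgO hhO h2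
    -- the residuals of the equation vanish on one side each, hence to infinite order along `Z`
    have h4 : VanishesOn Z k fun y => fderiv ℝ g y ν - N ((fderiv ℝ g y).comp π) :=
      vanishesOn_of_eqOn_zero hΩ hZ (hopen 1) (hcl 1 one_ne_zero) (hgν.sub hNg)
        (fun p hp => sub_eq_zero.2 (hgN p hp.1 (by simpa using hp.2))) k
    have h5 : VanishesOn Z k fun y => fderiv ℝ h y ν - N ((fderiv ℝ h y).comp π) :=
      vanishesOn_of_eqOn_zero hΩ hZ (hopen (-1)) (hcl (-1) (by norm_num)) (hhν.sub hNh)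
        (fun p hp => sub_eq_zero.2 (hhN p hp.1 (by simpa using hp.2))) k
    refine ((h4.sub hΩ hZ (hgν.sub hNg) (hhν.sub hNh) h5).add hΩ hZ
      ((hgν.sub hNg).sub (hhν.sub hNh)) (hNg.sub hNh) h3).congr hΩ hZ fun y hy => ?_
    beta_reduce
    rw [hfd y hy, sub_apply]
    simp only [Function.comp_apply]
    abel

end Evolution

/-! ### The special Lagrangian equation for graphs -/

section GraphEquation

variable {m : ℕ}

/-- The reflection of `ℝ^{m+1}` in the hyperplane on which the last coordinate vanishes. -/
def reflectLast (m : ℕ) : (Fin (m + 1) → ℝ) →L[ℝ] (Fin (m + 1) → ℝ) :=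
  ContinuousLinearMap.pi fun i =>
    (if i = Fin.last m then (-1 : ℝ) else 1) • ContinuousLinearMap.proj i

/-- The projection of `ℝ^{m+1}` onto the hyperplane on which the last coordinate vanishes. -/
def projInit (m : ℕ) : (Fin (m + 1) → ℝ) →L[ℝ] (Fin (m + 1) → ℝ) :=
  ContinuousLinearMap.pi fun i =>
    (if i = Fin.last m then (0 : ℝ) else 1) • ContinuousLinearMap.proj i

/-- The last coordinate on `ℝ^{m+1}`. -/
def lastCoord (m : ℕ) : (Fin (m + 1) → ℝ) →L[ℝ] ℝ := ContinuousLinearMap.proj (Fin.last m)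

theorem reflectLast_apply (y : Fin (m + 1) → ℝ) (i : Fin (m + 1)) :
    reflectLast m y i = (if i = Fin.last m then (-1 : ℝ) else 1) * y i := rfl

theorem projInit_apply (y : Fin (m + 1) → ℝ) (i : Fin (m + 1)) :
    projInit m y i = (if i = Fin.last m then (0 : ℝ) else 1) * y i := rfl

theorem lastCoord_apply (y : Fin (m + 1) → ℝ) : lastCoord m y = y (Fin.last m) := rfl

theorem reflectLast_reflectLast (y : Fin (m + 1) → ℝ) :
    reflectLast m (reflectLast m y) = y := by
  ext i
  rw [reflectLast_apply, reflectLast_apply]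
  split_ifs <;> simp

theorem lastCoord_reflectLast (y : Fin (m + 1) → ℝ) :
    lastCoord m (reflectLast m y) = -lastCoord m y := by
  simp [lastCoord_apply, reflectLast_apply]

theorem reflectLast_single (j : Fin (m + 1)) :
    reflectLast m (Pi.single j 1) =
      (if j = Fin.last m then (-1 : ℝ) else 1) • Pi.single j 1 := by
  ext i
  rw [reflectLast_apply]
  by_cases h : i = j
  · subst h; simp
  · simp [h]

theorem projInit_single (j : Fin (m + 1)) :
    projInit m (Pi.single j 1) =
      (if j = Fin.last m then (0 : ℝ) else 1) • Pi.single j 1 := by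
  ext i
  rw [projInit_apply]
  by_cases h : i = j
  · subst h; simp
  · simp [h]

theorem norm_reflectLast (y : Fin (m + 1) → ℝ) : ‖reflectLast m y‖ = ‖y‖ := by
  have : ∀ i, ‖reflectLast m y i‖ = ‖y i‖ := fun i => by
    rw [reflectLast_apply]
    split_ifs <;> simp
  simp only [Pi.norm_def]
  congr 1
  refine Finset.sup_congr rfl fun i _ => ?_
  exact NNReal.eq (this i)

/-- The complex matrix `1 + i A`, whose columns span the tangent plane of the graph
`{y + i g(y)}` at a point at which `g` has derivative `A`. -/
def graphMatrix (A : (Fin (m + 1) → ℝ) →L[ℝ] (Fin (m + 1) → ℝ)) :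
    Matrix (Fin (m + 1)) (Fin (m + 1)) ℂ :=
  Matrix.of fun i j => (1 : Matrix _ _ ℂ) i j + Complex.I * (A (Pi.single j 1) i : ℝ)

/-- The special Lagrangian condition on the derivative `A` of a map whose graph is considered:
`A` is symmetric, and `Im det (1 + i A) = 0`. -/
def IsSLDerivative (A : (Fin (m + 1) → ℝ) →L[ℝ] (Fin (m + 1) → ℝ)) : Prop :=
  (∀ i j, A (Pi.single i 1) j = A (Pi.single j 1) i) ∧ (graphMatrix A).det.im = 0

/-- The special Lagrangian condition is invariant under the reflection, as conjugation with a
diagonal matrix of signs preserves symmetry and determinant. -/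
theorem IsSLDerivative.reflect {A : (Fin (m + 1) → ℝ) →L[ℝ] (Fin (m + 1) → ℝ)}
    (hA : IsSLDerivative A) :
    IsSLDerivative ((reflectLast m).comp (A.comp (reflectLast m))) := by
  set ε : Fin (m + 1) → ℝ := fun i => if i = Fin.last m then (-1 : ℝ) else 1 with hε
  have hεε : ∀ i, ε i * ε i = 1 := fun i => by
    simp only [hε]
    split_ifs <;> norm_num
  have hent : ∀ i j, ((reflectLast m).comp (A.comp (reflectLast m))) (Pi.single j 1) i =
      ε i * (ε j * A (Pi.single j 1) i) := by
    intro i j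
    rw [ContinuousLinearMap.comp_apply, ContinuousLinearMap.comp_apply, reflectLast_apply,
      reflectLast_single, map_smul, Pi.smul_apply, smul_eq_mul]
  refine ⟨fun i j => by rw [hent, hent, hA.1 i j]; ring, ?_⟩
  have hmat : graphMatrix ((reflectLast m).comp (A.comp (reflectLast m))) =
      Matrix.diagonal (fun i => (ε i : ℂ)) * graphMatrix A *
        Matrix.diagonal (fun i => (ε i : ℂ)) := by
    ext i j
    rw [Matrix.mul_diagonal, Matrix.diagonal_mul]
    simp only [graphMatrix, Matrix.of_apply, hent]
    push_cast
    by_cases hij : i = j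
    · subst hij
      have : (ε i : ℂ) * ε i = 1 := mod_cast hεε i
      simp only [Matrix.one_apply_eq]
      linear_combination (-1 : ℂ) * this
    · rw [Matrix.one_apply_ne hij]
      ring
  have hdet : (Matrix.diagonal fun i => (ε i : ℂ)).det * (Matrix.diagonal fun i => (ε i : ℂ)).det
      = 1 := by
    rw [← Matrix.det_mul, Matrix.diagonal_mul_diagonal, ← Matrix.det_one (n := Fin (m + 1)),
      ← Matrix.diagonal_one]
    congr 2
    ext i
    exact_mod_cast hεε i
  rw [hmat, Matrix.det_mul, Matrix.det_mul, mul_comm, ← mul_assoc, hdet, one_mul]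
  exact hA.2

/-- The matrix `1 + i A`, with the last column filled in from the other ones by symmetry and the
last diagonal entry of `A` replaced by zero. It depends on the tangential part of `A` only. -/
def tangentialMatrix (A : (Fin (m + 1) → ℝ) →L[ℝ] (Fin (m + 1) → ℝ)) :
    Matrix (Fin (m + 1)) (Fin (m + 1)) ℂ :=
  Matrix.of fun i j => (1 : Matrix _ _ ℂ) i j +
    Complex.I * ((if j = Fin.last m then A (projInit m (Pi.single i 1)) (Fin.last m)
      else A (Pi.single j 1) i : ℝ) : ℂ)

/-- The coefficient of the last diagonal entry of `A` in the expansion of `det (1 + i A)`,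
up to the factor `i`. -/
def normalCoeff (A : (Fin (m + 1) → ℝ) →L[ℝ] (Fin (m + 1) → ℝ)) : ℂ :=
  ((tangentialMatrix A).updateCol (Fin.last m) (Pi.single (Fin.last m) 1)).det

/-- The special Lagrangian equation, solved for the normal derivative: `∂_t g_j = ∂_j g_t` for the
tangential components by symmetry, and the remaining entry is found from `Im det (1 + i A) = 0`,
which is affine in it. -/
def slEvolution (A : (Fin (m + 1) → ℝ) →L[ℝ] (Fin (m + 1) → ℝ)) : Fin (m + 1) → ℝ := fun j =>
  if j = Fin.last m then -(tangentialMatrix A).det.im / (normalCoeff A).re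
  else A (Pi.single j 1) (Fin.last m)

theorem tangentialMatrix_comp_projInit (A : (Fin (m + 1) → ℝ) →L[ℝ] (Fin (m + 1) → ℝ)) :
    tangentialMatrix (A.comp (projInit m)) = tangentialMatrix A := by
  ext i j
  simp only [tangentialMatrix, Matrix.of_apply, ContinuousLinearMap.comp_apply]
  by_cases hj : j = Fin.last m
  · rw [if_pos hj, if_pos hj, projInit_single]
    split_ifs with hi
    · simp
    · rw [one_smul, projInit_single, if_neg hi, one_smul]
  · rw [if_neg hj, if_neg hj, projInit_single, if_neg hj, one_smul]

/-- Under the special Lagrangian condition the normal part of `A` is determined by the tangential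
part, unless the coefficient of the last diagonal entry in the equation vanishes. -/
theorem IsSLDerivative.apply_last {A : (Fin (m + 1) → ℝ) →L[ℝ] (Fin (m + 1) → ℝ)}
    (hA : IsSLDerivative A) (h0 : (normalCoeff (A.comp (projInit m))).re ≠ 0) :
    A (Pi.single (Fin.last m) 1) = slEvolution (A.comp (projInit m)) := by
  have hN : normalCoeff (A.comp (projInit m)) = normalCoeff A := by
    rw [normalCoeff, normalCoeff, tangentialMatrix_comp_projInit]
  rw [hN] at h0
  ext j
  rw [slEvolution, tangentialMatrix_comp_projInit, hN]
  split_ifs with hj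
  · subst hj
    set c := A (Pi.single (Fin.last m) 1) (Fin.last m) with hc
    have hmat : graphMatrix A = (tangentialMatrix A).updateCol (Fin.last m)
        ((fun i => tangentialMatrix A i (Fin.last m)) +
          (Complex.I * c) • Pi.single (Fin.last m) 1) := by
      ext i j
      by_cases hj : j = Fin.last m
      · subst hj
        rw [Matrix.updateCol_self]
        simp only [graphMatrix, tangentialMatrix, Matrix.of_apply, if_true, Pi.add_apply,
          Pi.smul_apply, smul_eq_mul, projInit_single]
        by_cases hi : i = Fin.last m
        · subst hi
          simp [hc]
        · simp [hi, hA.1 (Fin.last m) i]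
      · rw [Matrix.updateCol_ne hj]
        simp [graphMatrix, tangentialMatrix, hj]
    have hdet : (graphMatrix A).det = (tangentialMatrix A).det +
        (Complex.I * c) * normalCoeff A := by
      rw [hmat, Matrix.det_updateCol_add, Matrix.det_updateCol_smul, normalCoeff]
      congr 2
      exact Matrix.updateCol_eq_self _ _
    have him := hA.2
    rw [hdet] at him
    simp only [Complex.add_im, Complex.mul_im, Complex.mul_re, Complex.I_re, Complex.I_im,
      Complex.ofReal_re, Complex.ofReal_im] at him
    rw [eq_div_iff h0]
    linarith
  · rw [ContinuousLinearMap.comp_apply, projInit_single, if_neg hj, one_smul, hA.1]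

theorem contDiff_det {V : Type*} [NormedAddCommGroup V] [NormedSpace ℝ V] {n : ℕ}
    {M : V → Matrix (Fin n) (Fin n) ℂ} (hM : ∀ i j, ContDiff ℝ ∞ fun x => M x i j) :
    ContDiff ℝ ∞ fun x => (M x).det := by
  simp only [Matrix.det_apply']
  exact ContDiff.sum fun σ _ => contDiff_const.mul (contDiff_prod fun i _ => hM _ _)

theorem contDiff_tangentialMatrix (i j : Fin (m + 1)) :
    ContDiff ℝ ∞ fun A : (Fin (m + 1) → ℝ) →L[ℝ] (Fin (m + 1) → ℝ) => tangentialMatrix A i j := by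
  have hent : ∀ (v : Fin (m + 1) → ℝ) (l : Fin (m + 1)), ContDiff ℝ ∞
      fun A : (Fin (m + 1) → ℝ) →L[ℝ] (Fin (m + 1) → ℝ) => ((A v l : ℝ) : ℂ) := fun v l =>
    Complex.ofRealCLM.contDiff.comp
      ((ContinuousLinearMap.proj (R := ℝ) (φ := fun _ : Fin (m + 1) => ℝ) l).contDiff.comp
        (contDiff_id.clm_apply contDiff_const))
  simp only [tangentialMatrix, Matrix.of_apply]
  refine contDiff_const.add (contDiff_const.mul ?_)
  split_ifs
  · exact hent _ _
  · exact hent _ _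

theorem contDiff_normalCoeff :
    ContDiff ℝ ∞ (normalCoeff : ((Fin (m + 1) → ℝ) →L[ℝ] (Fin (m + 1) → ℝ)) → ℂ) := by
  refine contDiff_det fun i j => ?_
  by_cases hj : j = Fin.last m
  · subst hj
    simpa only [Matrix.updateCol_self] using contDiff_const
  · simpa only [Matrix.updateCol_ne hj] using contDiff_tangentialMatrix i j

theorem isOpen_normalCoeff_ne :
    IsOpen {A : (Fin (m + 1) → ℝ) →L[ℝ] (Fin (m + 1) → ℝ) | (normalCoeff A).re ≠ 0} :=
  isOpen_ne_fun (Complex.continuous_re.comp contDiff_normalCoeff.continuous) continuous_const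

theorem contDiffOn_slEvolution :
    ContDiffOn ℝ ∞ (slEvolution : ((Fin (m + 1) → ℝ) →L[ℝ] (Fin (m + 1) → ℝ)) → _)
      {A | (normalCoeff A).re ≠ 0} := by
  refine contDiffOn_pi.2 fun j => ?_
  simp only [slEvolution]
  split_ifs
  · refine ContDiffOn.div ?_ (Complex.reCLM.contDiff.comp contDiff_normalCoeff).contDiffOn
      fun A hA => hA
    exact (Complex.imCLM.contDiff.comp (contDiff_det contDiff_tangentialMatrix)).neg.contDiffOn
  · exact ((ContinuousLinearMap.proj (R := ℝ) (φ := fun _ : Fin (m + 1) => ℝ)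
      (Fin.last m)).contDiff.comp (contDiff_id.clm_apply contDiff_const)).contDiffOn

theorem normalCoeff_zero :
    (normalCoeff (0 : (Fin (m + 1) → ℝ) →L[ℝ] (Fin (m + 1) → ℝ))).re = 1 := by
  have : (tangentialMatrix (0 : (Fin (m + 1) → ℝ) →L[ℝ] (Fin (m + 1) → ℝ))).updateCol
      (Fin.last m) (Pi.single (Fin.last m) 1) = 1 := by
    ext i j
    by_cases hj : j = Fin.last m
    · subst hj
      simp [Matrix.one_apply, Pi.single_apply]
    · simp [Matrix.updateCol_ne hj, tangentialMatrix]
  rw [normalCoeff, this, Matrix.det_one, Complex.one_re]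

/-- The reflection principle for graphs: if the graph of `g` over the half space is special
Lagrangian and meets `{t = 0}` in the fixed set of the reflection, then `g` and its reflected copy
fit together smoothly. -/
theorem contDiffOn_glue_reflect {Ω : Set (Fin (m + 1) → ℝ)} (hΩ : IsOpen Ω)
    (hΩr : ∀ y ∈ Ω, reflectLast m y ∈ Ω) {g : (Fin (m + 1) → ℝ) → (Fin (m + 1) → ℝ)}
    (hg : ContDiffOn ℝ ∞ g Ω)
    (hO : ∀ y ∈ Ω, (normalCoeff ((fderiv ℝ g y).comp (projInit m))).re ≠ 0)
    (hO' : ∀ y ∈ Ω, (normalCoeff ((((reflectLast m).comp ((fderiv ℝ g (reflectLast m y)).comp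
      (reflectLast m)))).comp (projInit m))).re ≠ 0)
    (hsl : ∀ y ∈ Ω, 0 < lastCoord m y → IsSLDerivative (fderiv ℝ g y))
    (h0 : ∀ y ∈ Ω, lastCoord m y = 0 → g y (Fin.last m) = 0) :
    (∀ y ∈ Ω, lastCoord m y = 0 → g y = reflectLast m (g (reflectLast m y))) ∧
    ContDiffOn ℝ ∞ (glue (lastCoord m) g fun y => reflectLast m (g (reflectLast m y))) Ω := by
  have hgh : ∀ y ∈ Ω, lastCoord m y = 0 → g y = reflectLast m (g (reflectLast m y)) := by
    intro y hy hty
    have : reflectLast m y = y := by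
      ext i
      rw [reflectLast_apply]
      split_ifs with hi
      · subst hi
        rw [lastCoord_apply] at hty
        simp [hty]
      · simp
    ext i
    rw [this, reflectLast_apply]
    split_ifs with hi
    · subst hi
      simp [h0 y hy hty]
    · simp
  refine ⟨hgh, ?_⟩
  have hh : ContDiffOn ℝ ∞ (fun y => reflectLast m (g (reflectLast m y))) Ω :=
    (reflectLast m).contDiff.comp_contDiffOn
      (hg.comp (reflectLast m).contDiff.contDiffOn hΩr)
  have hfd : ∀ y ∈ Ω, fderiv ℝ (fun y => reflectLast m (g (reflectLast m y))) y =
      (reflectLast m).comp ((fderiv ℝ g (reflectLast m y)).comp (reflectLast m)) := by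
    intro y hy
    exact ((reflectLast m).hasFDerivAt.comp y
      ((differentiableAt_of_contDiffOn hΩ hg (hΩr y hy)).hasFDerivAt.comp y
        (reflectLast m).hasFDerivAt)).fderiv
  refine contDiffOn_glue hΩ hg hh fun k => ?_
  refine vanishesOn_sub_of_evolution (ν := Pi.single (Fin.last m) 1) (π := projInit m) hΩ ?_ ?_ ?_
    isOpen_normalCoeff_ne contDiffOn_slEvolution hg hh hO ?_ ?_ ?_ hgh k
  · intro v
    ext i
    rw [Pi.add_apply, projInit_apply, Pi.smul_apply, lastCoord_apply]
    by_cases hi : i = Fin.last m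
    · subst hi; simp
    · simp [hi]
  · simp [lastCoord_apply]
  · intro v
    simp [lastCoord_apply, projInit_apply]
  · intro y hy
    rw [hfd y hy]
    exact hO' y hy
  · exact fun y hy hty => (hsl y hy hty).apply_last (hO y hy)
  · intro y hy hty
    rw [hfd y hy]
    refine (hsl _ (hΩr y hy) ?_).reflect.apply_last (hO' y hy)
    rw [lastCoord_reflectLast]
    linarith

end GraphEquation

/-! ### Submanifolds with boundary -/

section Submanifolds

variable {E : Type*} [NormedAddCommGroup E] [InnerProductSpace ℝ E]

theorem image_inter_source_eq_iff {X : Type*} [TopologicalSpace X]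
    (Φ : OpenPartialHomeomorph X X) (M C : Set X) :
    Φ '' (M ∩ Φ.source) = Φ.target ∩ C ↔ ∀ x ∈ Φ.source, (x ∈ M ↔ Φ x ∈ C) := by
  constructor
  · intro h x hx
    constructor
    · intro hM
      have : Φ x ∈ Φ '' (M ∩ Φ.source) := ⟨x, ⟨hM, hx⟩, rfl⟩
      rw [h] at this
      exact this.2
    · intro hC
      have : Φ x ∈ Φ '' (M ∩ Φ.source) := by
        rw [h]
        exact ⟨Φ.map_source hx, hC⟩
      obtain ⟨y, hy, hyx⟩ := this
      rw [← Φ.injOn hy.2 hx hyx]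
      exact hy.1
  · intro h
    ext z
    constructor
    · rintro ⟨x, ⟨hM, hx⟩, rfl⟩
      exact ⟨Φ.map_source hx, (h x hx).1 hM⟩
    · rintro ⟨hz, hC⟩
      refine ⟨Φ.symm z, ⟨(h _ (Φ.map_target hz)).2 ?_, Φ.map_target hz⟩, Φ.right_inv hz⟩
      rwa [Φ.right_inv hz]

theorem IsInteriorPoint.congr {d : ℕ} {M M' U : Set E} {x : E} (h : IsInteriorPoint d M x)
    (hU : IsOpen U) (hx : x ∈ U) (hMM : ∀ y ∈ U, (y ∈ M ↔ y ∈ M')) :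
    IsInteriorPoint d M' x := by
  obtain ⟨hM, Φ, V, hxs, h1, h2, hV, hI⟩ := h
  rw [image_inter_source_eq_iff] at hI
  have hsrc : (Φ.restrOpen U hU).source = Φ.source ∩ U := Φ.restrOpen_source U hU
  refine ⟨(hMM x hx).1 hM, Φ.restrOpen U hU, V, ?_, ?_, ?_, hV, ?_⟩
  · rw [hsrc]; exact ⟨hxs, hx⟩
  · rw [hsrc]; exact h1.mono Set.inter_subset_left
  · exact h2.mono fun z hz => hz.1
  · rw [image_inter_source_eq_iff]
    intro y hy
    rw [hsrc] at hy
    exact (hMM y hy.2).symm.trans (hI y hy.1)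

theorem IsBoundaryPoint.congr {d : ℕ} {M M' U : Set E} {x : E} (h : IsBoundaryPoint d M x)
    (hU : IsOpen U) (hx : x ∈ U) (hMM : ∀ y ∈ U, (y ∈ M ↔ y ∈ M')) :
    IsBoundaryPoint d M' x := by
  obtain ⟨hM, Φ, V, ℓ, hxs, h1, h2, hV, hℓ, hℓx, hI⟩ := h
  rw [image_inter_source_eq_iff] at hI
  have hsrc : (Φ.restrOpen U hU).source = Φ.source ∩ U := Φ.restrOpen_source U hU
  refine ⟨(hMM x hx).1 hM, Φ.restrOpen U hU, V, ℓ, ?_, ?_, ?_, hV, hℓ, hℓx, ?_⟩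
  · rw [hsrc]; exact ⟨hxs, hx⟩
  · rw [hsrc]; exact h1.mono Set.inter_subset_left
  · exact h2.mono fun z hz => hz.1
  · rw [image_inter_source_eq_iff]
    intro y hy
    rw [hsrc] at hy
    exact (hMM y hy.2).symm.trans (hI y hy.1)

theorem IsInteriorPoint.image {d : ℕ} {M : Set E} {x : E} (h : IsInteriorPoint d M x)
    (e : E ≃ₜ E) (he : ContDiff ℝ ∞ e) (he' : ContDiff ℝ ∞ e.symm) :
    IsInteriorPoint d (e '' M) (e x) := by
  obtain ⟨hM, Φ, V, hxs, h1, h2, hV, hI⟩ := h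
  rw [image_inter_source_eq_iff] at hI
  refine ⟨Set.mem_image_of_mem _ hM, e.symm.toOpenPartialHomeomorph.trans Φ, V, ?_, ?_, ?_, hV, ?_⟩
  · simpa using hxs
  · refine h1.comp he'.contDiffOn ?_
    intro y hy
    simpa using hy
  · refine he.comp_contDiffOn (h2.mono ?_)
    intro y hy
    simpa using hy
  · rw [image_inter_source_eq_iff]
    intro y hy
    have hy' : e.symm y ∈ Φ.source := by simpa using hy
    refine Iff.trans ?_ (hI _ hy')
    constructor
    · rintro ⟨z, hz, rfl⟩
      simpa using hz
    · intro hz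
      exact ⟨_, hz, e.apply_symm_apply y⟩

theorem IsBoundaryPoint.image {d : ℕ} {M : Set E} {x : E} (h : IsBoundaryPoint d M x)
    (e : E ≃ₜ E) (he : ContDiff ℝ ∞ e) (he' : ContDiff ℝ ∞ e.symm) :
    IsBoundaryPoint d (e '' M) (e x) := by
  obtain ⟨hM, Φ, V, ℓ, hxs, h1, h2, hV, hℓ, hℓx, hI⟩ := h
  rw [image_inter_source_eq_iff] at hI
  refine ⟨Set.mem_image_of_mem _ hM, e.symm.toOpenPartialHomeomorph.trans Φ, V, ℓ, ?_, ?_, ?_, hV,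
    hℓ, by simpa using hℓx, ?_⟩
  · simpa using hxs
  · refine h1.comp he'.contDiffOn ?_
    intro y hy
    simpa using hy
  · refine he.comp_contDiffOn (h2.mono ?_)
    intro y hy
    simpa using hy
  · rw [image_inter_source_eq_iff]
    intro y hy
    have hy' : e.symm y ∈ Φ.source := by simpa using hy
    refine Iff.trans ?_ (hI _ hy')
    constructor
    · rintro ⟨z, hz, rfl⟩
      simpa using hz
    · intro hz
      exact ⟨_, hz, e.apply_symm_apply y⟩

theorem boundary_image {d : ℕ} (M : Set E) (e : E ≃ₜ E) (he : ContDiff ℝ ∞ e)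
    (he' : ContDiff ℝ ∞ e.symm) : boundary d (e '' M) = e '' boundary d M := by
  ext x
  constructor
  · intro hx
    refine ⟨e.symm x, ?_, e.apply_symm_apply x⟩
    have := IsBoundaryPoint.image hx e.symm he' he
    rwa [← Set.image_comp, e.symm_comp_self, Set.image_id] at this
  · rintro ⟨y, hy, rfl⟩
    exact IsBoundaryPoint.image hy e he he'

/-! ### Tangent spaces -/

theorem tangentSpace_mono {M M' : Set E} (h : M ⊆ M') (x : E) :
    tangentSpace M x ≤ tangentSpace M' x :=
  Submodule.span_mono (tangentConeAt_mono h)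

theorem tangentSpace_inter_nhds {M U : Set E} {x : E} (hU : U ∈ nhds x) :
    tangentSpace (M ∩ U) x = tangentSpace M x := by
  rw [tangentSpace, tangentConeAt_inter_nhds hU, tangentSpace]

theorem tangentSpace_congr {M M' U : Set E} {x : E} (hU : U ∈ nhds x)
    (hMM : ∀ y ∈ U, (y ∈ M ↔ y ∈ M')) : tangentSpace M x = tangentSpace M' x := by
  rw [← tangentSpace_inter_nhds hU, ← tangentSpace_inter_nhds (M := M') hU]
  congr 1
  ext y
  exact ⟨fun h => ⟨(hMM y h.2).1 h.1, h.2⟩, fun h => ⟨(hMM y h.2).2 h.1, h.2⟩⟩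

theorem map_tangentSpace_le {F : Type*} [NormedAddCommGroup F] [InnerProductSpace ℝ F]
    {M : Set E} {x : E} {φ : E → F} {A : E →L[ℝ] F} (h : HasFDerivAt φ A x) :
    (tangentSpace M x).map (A : E →ₗ[ℝ] F) ≤ tangentSpace (φ '' M) (φ x) := by
  rw [tangentSpace, Submodule.map_span, tangentSpace]
  exact Submodule.span_mono h.hasFDerivWithinAt.mapsTo_tangent_cone.image_subset

theorem tangentSpace_image {M : Set E} {x : E} (e : E ≃ₜ E) (A : E ≃L[ℝ] E)
    (h : HasFDerivAt e (A : E →L[ℝ] E) x)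
    (h' : HasFDerivAt e.symm (A.symm : E →L[ℝ] E) (e x)) :
    tangentSpace (e '' M) (e x) =
      (tangentSpace M x).map ((A : E →L[ℝ] E) : E →ₗ[ℝ] E) := by
  refine le_antisymm ?_ (map_tangentSpace_le h)
  intro u hu
  have h1 := map_tangentSpace_le (M := e '' M) h' ⟨u, hu, rfl⟩
  rw [← Set.image_comp, e.symm_comp_self, Set.image_id, e.symm_apply_apply] at h1
  exact ⟨_, h1, A.apply_symm_apply u⟩

/-- A chart has an invertible derivative at each point of its domain. -/
theorem exists_equiv_hasFDerivAt {Φ : OpenPartialHomeomorph E E}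
    (h1 : ContDiffOn ℝ ∞ Φ Φ.source) (h2 : ContDiffOn ℝ ∞ Φ.symm Φ.target) {x : E}
    (hx : x ∈ Φ.source) :
    ∃ A : E ≃L[ℝ] E, HasFDerivAt Φ (A : E →L[ℝ] E) x ∧
      HasFDerivAt Φ.symm (A.symm : E →L[ℝ] E) (Φ x) := by
  have d1 := ((h1.contDiffAt (Φ.open_source.mem_nhds hx)).differentiableAt
    (by simp)).hasFDerivAt
  have d2 := ((h2.contDiffAt (Φ.open_target.mem_nhds (Φ.map_source hx))).differentiableAt
    (by simp)).hasFDerivAt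
  have e1 := d2.comp x d1
  have e2 : HasFDerivAt (Φ ∘ Φ.symm)
      ((fderiv ℝ Φ x).comp (fderiv ℝ Φ.symm (Φ x))) (Φ x) := by
    refine HasFDerivAt.comp (Φ x) ?_ d2
    rwa [Φ.left_inv hx]
  have i1 : fderiv ℝ Φ.symm (Φ x) ∘L fderiv ℝ Φ x = ContinuousLinearMap.id ℝ E := by
    refine (e1.congr_of_eventuallyEq ?_).unique (hasFDerivAt_id x)
    filter_upwards [Φ.open_source.mem_nhds hx] with y hy using (Φ.left_inv hy).symm
  have i2 : fderiv ℝ Φ x ∘L fderiv ℝ Φ.symm (Φ x) = ContinuousLinearMap.id ℝ E := by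
    refine (e2.congr_of_eventuallyEq ?_).unique (hasFDerivAt_id _)
    filter_upwards [Φ.open_target.mem_nhds (Φ.map_source hx)] with y hy
      using (Φ.right_inv hy).symm
  exact ⟨ContinuousLinearEquiv.equivOfInverse _ _ (DFunLike.congr_fun i1) (DFunLike.congr_fun i2),
    d1, d2⟩

theorem finrank_comap_equiv (A : E ≃L[ℝ] E) (V : Submodule ℝ E) :
    Module.finrank ℝ (V.comap ((A : E →L[ℝ] E) : E →ₗ[ℝ] E)) = Module.finrank ℝ V := by
  have : V.comap ((A : E →L[ℝ] E) : E →ₗ[ℝ] E) = V.map (A.symm.toLinearEquiv : E →ₗ[ℝ] E) := by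
    ext u
    constructor
    · intro hu
      exact ⟨_, hu, A.symm_apply_apply u⟩
    · rintro ⟨w, hw, rfl⟩
      simpa using hw
  rw [this]
  exact LinearEquiv.finrank_map_eq A.symm.toLinearEquiv V

variable [FiniteDimensional ℝ E]

theorem deriv_mem_of_eventually_mem (V : Submodule ℝ E) {c : ℝ → E} {c' : E}
    (h : HasDerivAt c c' 0) (hc : ∀ᶠ s in nhds 0, c s - c 0 ∈ V) : c' ∈ V := by
  have hcl : IsClosed (V : Set E) := V.closed_of_finiteDimensional
  have h1 := h.tendsto_slope_zero
  refine hcl.mem_of_tendsto h1 ?_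
  filter_upwards [hc.filter_mono nhdsWithin_le_nhds] with s hs
  simpa using V.smul_mem _ hs

theorem tangentSpace_le_of_subset (V : Submodule ℝ E) {M : Set E} {p : E}
    (h : ∀ y ∈ M, y - p ∈ V) : tangentSpace M p ≤ V := by
  have hcl : IsClosed (V : Set E) := V.closed_of_finiteDimensional
  refine Submodule.span_le.2 fun u hu => ?_
  obtain ⟨α, l, hl, c, d, -, hd, hcd⟩ := exists_fun_of_mem_tangentConeAt hu
  refine hcl.mem_of_tendsto hcd ?_
  filter_upwards [hd] with a ha
  exact V.smul_mem _ (by simpa using h _ ha)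

theorem tangentSpace_le_comap {Φ : OpenPartialHomeomorph E E} {A : E →L[ℝ] E} {x : E}
    (hx : x ∈ Φ.source) (hA : HasFDerivAt Φ A x) {M : Set E} (V : Submodule ℝ E) (hxM : Φ x ∈ V)
    (hM : ∀ y ∈ Φ.source, y ∈ M → Φ y ∈ V) :
    tangentSpace M x ≤ V.comap (A : E →ₗ[ℝ] E) := by
  rw [← tangentSpace_inter_nhds (Φ.open_source.mem_nhds hx), ← Submodule.map_le_iff_le_comap]
  refine (map_tangentSpace_le hA).trans (tangentSpace_le_of_subset V ?_)
  rintro _ ⟨y, hy, rfl⟩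
  exact V.sub_mem (hM y hy.2 hy.1) hxM

theorem IsInteriorPoint.finrank_tangentSpace_le {d : ℕ} {M : Set E} {x : E}
    (h : IsInteriorPoint d M x) : Module.finrank ℝ (tangentSpace M x) ≤ d := by
  obtain ⟨hM, Φ, V, hxs, h1, h2, hV, hI⟩ := h
  rw [image_inter_source_eq_iff] at hI
  obtain ⟨A, hA, -⟩ := exists_equiv_hasFDerivAt h1 h2 hxs
  have := Submodule.finrank_mono (tangentSpace_le_comap hxs hA V ((hI x hxs).1 hM)
    fun y hy hyM => (hI y hy).1 hyM)
  rwa [finrank_comap_equiv, hV] at this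

/-- A point of a submanifold cannot be both an interior point and a boundary point: read in the
boundary chart, a curve through the point in the interior chart has a minimum of `ℓ` there, so `ℓ`
would vanish on the whole tangent space. -/
theorem IsInteriorPoint.not_isBoundaryPoint {d : ℕ} {M : Set E} {x : E}
    (h : IsInteriorPoint d M x) : ¬ IsBoundaryPoint d M x := by
  rintro ⟨-, Ψ, W, ℓ, hxs', h1', h2', hW, ⟨w₀, hw₀, hℓ⟩, hℓx, hI'⟩
  obtain ⟨hM, Φ, V, hxs, h1, h2, hV, hI⟩ := h
  rw [image_inter_source_eq_iff] at hI hI'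
  obtain ⟨A, hA, hA'⟩ := exists_equiv_hasFDerivAt h1 h2 hxs
  obtain ⟨B, hB, -⟩ := exists_equiv_hasFDerivAt h1' h2' hxs'
  have key : ∀ v ∈ V, B (A.symm v) ∈ W ∧ ℓ (B (A.symm v)) = 0 := by
    intro v hv
    let c : ℝ → E := fun s => Ψ (Φ.symm (Φ x + s • v))
    have hline : HasDerivAt (fun s : ℝ => Φ x + s • v) v 0 := by
      simpa using ((hasDerivAt_id (0 : ℝ)).smul_const v).const_add (Φ x)
    have hc0 : Φ.symm (Φ x + (0 : ℝ) • v) = x := by simp [Φ.left_inv hxs]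
    have hinner : HasDerivAt (fun s : ℝ => Φ.symm (Φ x + s • v)) (A.symm v) 0 := by
      refine HasFDerivAt.comp_hasDerivAt (0 : ℝ) (l' := (A.symm : E →L[ℝ] E)) ?_ hline
      simpa using hA'
    have hc : HasDerivAt c (B (A.symm v)) 0 := by
      refine HasFDerivAt.comp_hasDerivAt (0 : ℝ) (l' := (B : E →L[ℝ] E)) ?_ hinner
      rwa [hc0]
    have hev : ∀ᶠ s in nhds (0 : ℝ), c s ∈ W ∧ 0 ≤ ℓ (c s) := by
      have e1 : ∀ᶠ s in nhds (0 : ℝ), Φ x + s • v ∈ Φ.target :=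
        hline.continuousAt (Φ.open_target.mem_nhds (by simpa using Φ.map_source hxs))
      have e2 : ∀ᶠ s in nhds (0 : ℝ), Φ.symm (Φ x + s • v) ∈ Ψ.source :=
        hinner.continuousAt (Ψ.open_source.mem_nhds (by rwa [hc0]))
      filter_upwards [e1, e2] with s hs1 hs2
      refine (hI' _ hs2).1 ((hI _ (Φ.map_target hs1)).2 ?_)
      rw [Φ.right_inv hs1]
      exact V.add_mem ((hI x hxs).1 hM) (V.smul_mem _ hv)
    have hcx : c 0 = Ψ x := by simp only [c, hc0]
    constructor
    · refine deriv_mem_of_eventually_mem W hc ?_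
      filter_upwards [hev] with s hs
      refine W.sub_mem hs.1 ?_
      rw [hcx]
      exact ((hI' x hxs').1 hM).1
    · have hmin : IsLocalMin (fun s => ℓ (c s)) 0 := by
        filter_upwards [hev] with s hs
        rw [hcx, hℓx]
        exact hs.2
      exact hmin.hasDerivAt_eq_zero (ℓ.hasFDerivAt.comp_hasDerivAt (0 : ℝ) hc)
  let C : E ≃L[ℝ] E := B.symm.trans A
  have hle : V ≤ W.comap ((C.symm : E →L[ℝ] E) : E →ₗ[ℝ] E) := fun v hv => (key v hv).1
  have heq := Submodule.eq_of_le_of_finrank_eq hle (by rw [finrank_comap_equiv, hV, hW])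
  have hmem : C w₀ ∈ V := by
    rw [heq]
    simpa using hw₀
  apply hℓ
  have := (key _ hmem).2
  simpa [C] using this

end Submanifolds

/-! ### Graphs over a half space -/

section LocalGraphs

/-- A chart of a `d`-dimensional submanifold in a `2d`-dimensional space, together with linear
coordinates `a` that are nondegenerate on the tangent space at `x₀`, yields by the inverse function
theorem a parametrization `γ` of the submanifold by those coordinates. -/
theorem exists_parametrization {E X : Type*} [NormedAddCommGroup E] [InnerProductSpace ℝ E]
    [FiniteDimensional ℝ E] [NormedAddCommGroup X] [NormedSpace ℝ X] [FiniteDimensional ℝ X]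
    (hdim : Module.finrank ℝ E = 2 * Module.finrank ℝ X) {Φ : OpenPartialHomeomorph E E}
    (h1 : ContDiffOn ℝ ∞ Φ Φ.source) {V : Submodule ℝ E}
    (hV : Module.finrank ℝ V = Module.finrank ℝ X) {x₀ : E} (hx : x₀ ∈ Φ.source)
    (hxV : Φ x₀ ∈ V) {A : E →L[ℝ] E} (hA : HasFDerivAt Φ A x₀) (a : E →L[ℝ] X)
    (hinj : ∀ u, A u ∈ V → a u = 0 → u = 0) :
    ∃ (U : Set E) (Ω : Set X) (γ : X → E), IsOpen U ∧ x₀ ∈ U ∧ U ⊆ Φ.source ∧ IsOpen Ω ∧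
      (0 : X) ∈ Ω ∧ ContDiffOn ℝ ∞ γ Ω ∧
      (∀ y ∈ Ω, γ y ∈ U ∧ a (γ y - x₀) = y ∧ Φ (γ y) ∈ V) ∧
      ∀ x ∈ U, Φ x ∈ V → a (x - x₀) ∈ Ω ∧ γ (a (x - x₀)) = x := by
  -- a linear map `q` to `X` with kernel `V`, so that `q ∘ Φ` defines the submanifold
  have hq : Module.finrank ℝ (E ⧸ V) = Module.finrank ℝ X := by
    rw [Submodule.finrank_quotient, hdim, hV]
    omega
  let qe : (E ⧸ V) ≃ₗ[ℝ] X := LinearEquiv.ofFinrankEq _ _ hq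
  let q : E →L[ℝ] X := LinearMap.toContinuousLinearMap (qe.toLinearMap.comp V.mkQ)
  have hqV : ∀ z, q z = 0 ↔ z ∈ V := fun z => by
    change qe (V.mkQ z) = 0 ↔ _
    rw [LinearEquiv.map_eq_zero_iff, Submodule.mkQ_apply, Submodule.Quotient.mk_eq_zero]
  let Ψ : E → X × X := fun x => (a (x - x₀), q (Φ x))
  have hΨ : ContDiffOn ℝ ∞ Ψ Φ.source :=
    ((a.contDiff.comp (contDiff_id.sub contDiff_const)).contDiffOn).prodMk
      (q.contDiff.comp_contDiffOn h1)
  have hΨd : HasFDerivAt Ψ (a.prod (q.comp A)) x₀ := by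
    have e1 : HasFDerivAt (fun x => a (x - x₀)) a x₀ :=
      (a.hasFDerivAt.comp x₀ ((hasFDerivAt_id x₀).sub_const x₀)).congr_fderiv a.comp_id
    exact e1.prodMk (q.hasFDerivAt.comp x₀ hA)
  have hDinj : Function.Injective (a.prod (q.comp A) : E →ₗ[ℝ] X × X) := by
    rw [← LinearMap.ker_eq_bot, LinearMap.ker_eq_bot']
    intro u hu
    have hu' : (a u, q (A u)) = 0 := hu
    exact hinj u ((hqV _).1 (congrArg Prod.snd hu')) (congrArg Prod.fst hu')
  let D : E ≃L[ℝ] X × X := (LinearMap.linearEquivOfInjective _ hDinj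
    (by rw [Module.finrank_prod, hdim, two_mul])).toContinuousLinearEquiv
  have hD : (D : E →L[ℝ] X × X) = a.prod (q.comp A) := by
    ext u <;> rfl
  have hnhds : Φ.source ∈ nhds x₀ := Φ.open_source.mem_nhds hx
  have hstrict : HasStrictFDerivAt Ψ (D : E →L[ℝ] X × X) x₀ :=
    (hΨ.contDiffAt hnhds).hasStrictFDerivAt' (hD ▸ hΨd) (by simp)
  let Γ := hstrict.toOpenPartialHomeomorph Ψ
  -- shrink to the open set on which the derivative is invertible, so that `Γ.symm` is smooth
  let U₁ : Set E := Φ.source ∩ fderiv ℝ Ψ ⁻¹' Set.range ContinuousLinearEquiv.toContinuousLinearMap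
  have hU₁ : IsOpen U₁ := (hΨ.continuousOn_fderiv_of_isOpen Φ.open_source
    (by simp)).isOpen_inter_preimage Φ.open_source ContinuousLinearEquiv.isOpen
  have hxU₁ : x₀ ∈ U₁ := ⟨hx, D, by rw [hΨd.fderiv, hD]⟩
  let Γ' := Γ.restrOpen U₁ hU₁
  have hsrc : Γ'.source = Γ.source ∩ U₁ := Γ.restrOpen_source U₁ hU₁
  have hΓ' : ∀ x, Γ' x = Ψ x := fun x => rfl
  have hx₀ : x₀ ∈ Γ'.source := by
    rw [hsrc]
    exact ⟨hstrict.mem_toOpenPartialHomeomorph_source, hxU₁⟩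
  have hsymm : ContDiffOn ℝ ∞ Γ'.symm Γ'.target := by
    intro z hz
    have hs := Γ'.map_target hz
    rw [hsrc] at hs
    obtain ⟨hs1, B, hB⟩ := hs.2
    have hdiff : DifferentiableAt ℝ Ψ (Γ'.symm z) :=
      (hΨ.contDiffAt (Φ.open_source.mem_nhds hs1)).differentiableAt (by simp)
    refine (Γ'.contDiffAt_symm (f₀' := B) hz ?_
      (hΨ.contDiffAt (Φ.open_source.mem_nhds hs1))).contDiffWithinAt
    rw [hB]
    exact hdiff.hasFDerivAt
  have hincl : Continuous fun y : X => (y, (0 : X)) := by fun_prop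
  refine ⟨Γ'.source, (fun y : X => (y, (0 : X))) ⁻¹' Γ'.target, fun y => Γ'.symm (y, 0),
    Γ'.open_source, hx₀, ?_, Γ'.open_target.preimage hincl, ?_, ?_, ?_, ?_⟩
  · rw [hsrc]
    exact fun x hx => hx.2.1
  · have : Γ' x₀ = (0, 0) := by
      rw [hΓ']
      simp only [Ψ, sub_self, map_zero, (hqV _).2 hxV]
    change ((0 : X), (0 : X)) ∈ Γ'.target
    rw [← this]
    exact Γ'.map_source hx₀
  · exact hsymm.comp (contDiff_id.prodMk contDiff_const).contDiffOn fun y hy => hy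
  · intro y hy
    have := Γ'.right_inv hy
    rw [hΓ'] at this
    exact ⟨Γ'.map_target hy, congrArg Prod.fst this, (hqV _).1 (congrArg Prod.snd this)⟩
  · intro x hx hxV
    have : Γ' x = (a (x - x₀), 0) := by
      rw [hΓ']
      simp only [Ψ, (hqV _).2 hxV]
    constructor
    · change (a (x - x₀), (0 : X)) ∈ Γ'.target
      rw [← this]
      exact Γ'.map_source hx
    · change Γ'.symm (a (x - x₀), 0) = x
      rw [← this]
      exact Γ'.left_inv hx

/-- If the zeros of `lam` near the origin lie in the hyperplane `{y_m = 0}`, to which `lam` is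
transversal at the origin, then `lam` has the sign of the last coordinate. -/
theorem exists_ball_sign {m : ℕ} {Ω : Set (Fin (m + 1) → ℝ)} (hΩ : IsOpen Ω) (h0 : 0 ∈ Ω)
    {lam : (Fin (m + 1) → ℝ) → ℝ} (hl : ContDiffOn ℝ ∞ lam Ω) (hl0 : lam 0 = 0)
    (hd : 0 < fderiv ℝ lam 0 (Pi.single (Fin.last m) 1))
    (hz : ∀ y ∈ Ω, lam y = 0 → y (Fin.last m) = 0) :
    ∃ ε > 0, Metric.ball (0 : Fin (m + 1) → ℝ) ε ⊆ Ω ∧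
      ∀ y ∈ Metric.ball (0 : Fin (m + 1) → ℝ) ε, (0 ≤ lam y ↔ 0 ≤ y (Fin.last m)) ∧
        (lam y = 0 ↔ y (Fin.last m) = 0) := by
  set ν : Fin (m + 1) → ℝ := Pi.single (Fin.last m) 1 with hν
  have hcont : ContinuousOn (fun y => fderiv ℝ lam y ν) Ω :=
    (contDiffOn_fderiv hΩ hl).continuousOn.clm_apply continuousOn_const
  have hpos : Ω ∩ (fun y => fderiv ℝ lam y ν) ⁻¹' Set.Ioi 0 ∈ nhds (0 : Fin (m + 1) → ℝ) :=
    (hcont.isOpen_inter_preimage hΩ isOpen_Ioi).mem_nhds ⟨h0, hd⟩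
  obtain ⟨r, hr, hball⟩ := Metric.mem_nhds_iff.1 hpos
  -- `lam` is strictly increasing along the segments `s ↦ (y', s)`
  let upd : (Fin (m + 1) → ℝ) → ℝ → (Fin (m + 1) → ℝ) := fun y s =>
    Function.update y (Fin.last m) s
  have hupd : ∀ y s, y ∈ Metric.ball (0 : Fin (m + 1) → ℝ) r → |s| < r →
      upd y s ∈ Metric.ball (0 : Fin (m + 1) → ℝ) r := by
    intro y s hy hs
    rw [mem_ball_zero_iff, pi_norm_lt_iff hr] at hy ⊢
    intro i
    by_cases hi : i = Fin.last m
    · subst hi; simpa [upd] using hs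
    · simpa [upd, hi] using hy i
  have hder : ∀ y s, y ∈ Metric.ball (0 : Fin (m + 1) → ℝ) r → |s| < r →
      HasDerivAt (fun s => lam (upd y s)) (fderiv ℝ lam (upd y s) ν) s := by
    intro y s hy hs
    have h1 := (differentiableAt_of_contDiffOn hΩ hl (hball (hupd y s hy hs)).1).hasFDerivAt
    have h2 : HasDerivAt (upd y) ν s := by
      simpa [upd, hν] using hasDerivAt_update y (Fin.last m) s
    exact h1.comp_hasDerivAt s h2
  have hmono : ∀ y ∈ Metric.ball (0 : Fin (m + 1) → ℝ) r,
      StrictMonoOn (fun s => lam (upd y s)) (Set.Ioo (-r) r) := by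
    intro y hy
    refine strictMonoOn_of_deriv_pos (convex_Ioo _ _) ?_ ?_
    · intro s hs
      exact (hder y s hy (abs_lt.2 hs)).continuousAt.continuousWithinAt
    · intro s hs
      rw [interior_Ioo] at hs
      have hs' := abs_lt.2 hs
      rw [(hder y s hy hs').deriv]
      exact (hball (hupd y s hy hs')).2
  have h0r : (0 : Fin (m + 1) → ℝ) ∈ Metric.ball (0 : Fin (m + 1) → ℝ) r :=
    Metric.mem_ball_self hr
  have hupd00 : upd 0 0 = 0 := Function.update_eq_self _ _
  set δ := r / 2 with hδ
  have hδ0 : 0 < δ := by positivity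
  have hδr : δ < r := by linarith
  have hp : 0 < lam (upd 0 δ) := by
    have := hmono 0 h0r ⟨by linarith, hr⟩ ⟨by linarith, hδr⟩ hδ0
    simpa only [hupd00, hl0] using this
  have hn : lam (upd 0 (-δ)) < 0 := by
    have := hmono 0 h0r ⟨by linarith, by linarith⟩ ⟨by linarith, hr⟩
      (by linarith : -δ < (0 : ℝ))
    simpa only [hupd00, hl0] using this
  have hcu : ∀ s, |s| < r → ContinuousAt (fun y => lam (upd y s)) 0 := by
    intro s hs
    have h1 : ContinuousAt lam (upd 0 s) := hl.continuousOn.continuousAt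
      (hΩ.mem_nhds (hball (hupd 0 s h0r hs)).1)
    have h2 : Continuous fun y : Fin (m + 1) → ℝ => upd y s :=
      continuous_id.update (Fin.last m) continuous_const
    exact ContinuousAt.comp (f := fun y => upd y s) h1 h2.continuousAt
  have hδa : |δ| < r := by rwa [abs_of_pos hδ0]
  have hev := ((hcu δ hδa).eventually (lt_mem_nhds hp)).and
    ((hcu (-δ) (by rwa [abs_neg])).eventually (gt_mem_nhds hn))
  obtain ⟨r', hr', hball'⟩ := Metric.mem_nhds_iff.1
    (Filter.inter_mem hev (Metric.ball_mem_nhds _ hr))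
  refine ⟨r', hr', fun y hy => (hball (hball' hy).2).1, fun y hy => ?_⟩
  obtain ⟨⟨hyp, hyn⟩, hyr⟩ := hball' hy
  have hcy : ContinuousOn (fun s => lam (upd y s)) (Set.Icc (-δ) δ) := fun s hs =>
    (hder y s hyr
      (abs_lt.2 ⟨by linarith [hs.1], by linarith [hs.2]⟩)).continuousAt.continuousWithinAt
  obtain ⟨s, hs, hs0⟩ := intermediate_value_Icc (by linarith : -δ ≤ δ) hcy ⟨hyn.le, hyp.le⟩
  have hsr : |s| < r := abs_lt.2 ⟨by linarith [hs.1], by linarith [hs.2]⟩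
  have hs00 : s = 0 := by
    simpa [upd] using hz _ (hball (hupd y s hyr hsr)).1 hs0
  rw [hs00] at hs0
  have hself : upd y (y (Fin.last m)) = y := Function.update_eq_self _ _
  have hyl : y (Fin.last m) ∈ Set.Ioo (-r) r := by
    rw [mem_ball_zero_iff, pi_norm_lt_iff hr] at hyr
    exact abs_lt.1 (hyr _)
  have hzero : (0 : ℝ) ∈ Set.Ioo (-r) r := ⟨by linarith, hr⟩
  have k1 := (hmono y hyr).le_iff_le hzero hyl
  have k2 := (hmono y hyr).eq_iff_eq hyl hzero
  simp only [hself, hs0] at k1 k2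
  exact ⟨k1, k2⟩

/-- Near its points, the graph of a smooth function is a submanifold without boundary. -/
theorem isInteriorPoint_of_graph {E X : Type*} [NormedAddCommGroup E] [InnerProductSpace ℝ E]
    [NormedAddCommGroup X] [NormedSpace ℝ X] {d : ℕ}
    (hd : Module.finrank ℝ X = d) (κ : E ≃L[ℝ] X × X) (x₀ : E) {Ω : Set X} (hΩ : IsOpen Ω)
    {G : X → X} (hG : ContDiffOn ℝ ∞ G Ω) {M U : Set E} (hU : IsOpen U)
    (hUΩ : ∀ x ∈ U, (κ (x - x₀)).1 ∈ Ω)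
    (hM : ∀ x ∈ U, (x ∈ M ↔ (κ (x - x₀)).2 = G (κ (x - x₀)).1)) {x : E} (hxU : x ∈ U)
    (hxM : x ∈ M) : IsInteriorPoint d M x := by
  have hκx : ContDiff ℝ ∞ fun x : E => κ (x - x₀) :=
    κ.contDiff.comp (contDiff_id.sub contDiff_const)
  have ho1 : IsOpen {x : E | (κ (x - x₀)).1 ∈ Ω} :=
    hΩ.preimage (continuous_fst.comp hκx.continuous)
  have ho2 : IsOpen {z : E | (κ z).1 ∈ Ω} := hΩ.preimage (continuous_fst.comp κ.continuous)
  have hs1 : ContDiffOn ℝ ∞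
      (fun x : E => κ.symm ((κ (x - x₀)).1, (κ (x - x₀)).2 - G (κ (x - x₀)).1))
      {x : E | (κ (x - x₀)).1 ∈ Ω} :=
    κ.symm.contDiff.comp_contDiffOn ((contDiff_fst.comp hκx).contDiffOn.prodMk
      ((contDiff_snd.comp hκx).contDiffOn.sub
        (hG.comp (contDiff_fst.comp hκx).contDiffOn fun x hx => hx)))
  have hs2 : ContDiffOn ℝ ∞ (fun z : E => κ.symm ((κ z).1, (κ z).2 + G (κ z).1) + x₀)
      {z : E | (κ z).1 ∈ Ω} :=
    (κ.symm.contDiff.comp_contDiffOn ((contDiff_fst.comp κ.contDiff).contDiffOn.prodMk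
      ((contDiff_snd.comp κ.contDiff).contDiffOn.add
        (hG.comp (contDiff_fst.comp κ.contDiff).contDiffOn fun x hx => hx)))).add
      contDiffOn_const
  let Φ : OpenPartialHomeomorph E E :=
    { toFun := fun x => κ.symm ((κ (x - x₀)).1, (κ (x - x₀)).2 - G (κ (x - x₀)).1)
      invFun := fun z => κ.symm ((κ z).1, (κ z).2 + G (κ z).1) + x₀
      source := {x | (κ (x - x₀)).1 ∈ Ω}
      target := {z | (κ z).1 ∈ Ω}
      map_source' := fun x hx => by simpa using hx
      map_target' := fun z hz => by simpa using hz
      left_inv' := fun x _ => by simp [-map_sub]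
      right_inv' := fun z _ => by simp
      open_source := ho1
      open_target := ho2
      continuousOn_toFun := hs1.continuousOn
      continuousOn_invFun := hs2.continuousOn }
  let V : Submodule ℝ E := LinearMap.range
    (κ.symm.toLinearEquiv.toLinearMap.comp (LinearMap.inl ℝ X X))
  have hVmem : ∀ z, z ∈ V ↔ (κ z).2 = 0 := by
    intro z
    constructor
    · rintro ⟨y, rfl⟩
      simp
    · intro hz
      refine ⟨(κ z).1, ?_⟩
      change κ.symm ((κ z).1, 0) = z
      rw [← hz]
      simp
  have hVd : Module.finrank ℝ V = d := by
    rw [← hd]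
    refine LinearMap.finrank_range_of_inj ?_
    exact κ.symm.injective.comp LinearMap.inl_injective
  have hsrc : (Φ.restrOpen U hU).source = Φ.source ∩ U := Φ.restrOpen_source U hU
  refine ⟨hxM, Φ.restrOpen U hU, V, ?_, ?_, ?_, hVd, ?_⟩
  · rw [hsrc]; exact ⟨hUΩ x hxU, hxU⟩
  · rw [hsrc]; exact hs1.mono Set.inter_subset_left
  · exact hs2.mono fun z hz => hz.1
  · rw [image_inter_source_eq_iff]
    intro y hy
    rw [hsrc] at hy
    refine (hM y hy.2).trans ?_
    change _ ↔ κ.symm ((κ (y - x₀)).1, (κ (y - x₀)).2 - G (κ (y - x₀)).1) ∈ V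
    rw [hVmem, ContinuousLinearEquiv.apply_symm_apply, sub_eq_zero]

/-- A submanifold with boundary is locally closed at its boundary points. -/
theorem IsBoundaryPoint.exists_closure_inter_subset {E : Type*} [NormedAddCommGroup E]
    [InnerProductSpace ℝ E] [FiniteDimensional ℝ E] {d : ℕ} {M : Set E} {x : E}
    (h : IsBoundaryPoint d M x) : ∃ U, IsOpen U ∧ x ∈ U ∧ closure M ∩ U ⊆ M := by
  obtain ⟨hM, Φ, V, ℓ, hxs, h1, h2, hV, hℓ, hℓx, hI⟩ := h
  rw [image_inter_source_eq_iff] at hI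
  refine ⟨Φ.source, Φ.open_source, hxs, fun y hy => (hI y hy.2).2 ?_⟩
  have hcl : IsClosed {v | v ∈ V ∧ 0 ≤ ℓ v} :=
    V.closed_of_finiteDimensional.inter (isClosed_le continuous_const ℓ.continuous)
  have hy' : y ∈ closure (M ∩ Φ.source) := by
    rw [mem_closure_iff_nhdsWithin_neBot, nhdsWithin_inter_of_mem'
      (mem_nhdsWithin_of_mem_nhds (Φ.open_source.mem_nhds hy.2)),
      ← mem_closure_iff_nhdsWithin_neBot]
    exact hy.1
  have hc : ContinuousAt Φ y := Φ.continuousAt hy.2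
  have := mem_closure_image hc hy'
  refine hcl.closure_subset_iff.2 ?_ this
  rintro _ ⟨z, hz, rfl⟩
  exact (hI z hz.2).1 hz.1

end LocalGraphs

/-! ### Unitary frames -/

section Frames

theorem det_of_eq_basis_det {n : ℕ} (v : Fin n → EuclideanSpace ℂ (Fin n)) :
    Matrix.det (Matrix.of fun i j => v i j) =
      (EuclideanSpace.basisFun (Fin n) ℂ).toBasis.det v := by
  rw [Module.Basis.det_apply, ← Matrix.det_transpose]
  congr 1

theorem finrank_real_euclideanSpace (n : ℕ) :
    Module.finrank ℝ (EuclideanSpace ℂ (Fin n)) = 2 * n := by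
  rw [← Module.finrank_mul_finrank ℝ ℂ]
  simp

theorem real_inner_eq_re {n : ℕ} (u w : EuclideanSpace ℂ (Fin n)) :
    inner ℝ u w = (inner ℂ u w).re := by
  simp [PiLp.inner_apply, Complex.inner]

/-- The real coordinates `(a, b)` of the vector `∑ (a_j + i b_j) e_j` in a unitary frame `e`. -/
def frameEquiv {n : ℕ} (e : OrthonormalBasis (Fin n) ℂ (EuclideanSpace ℂ (Fin n))) :
    EuclideanSpace ℂ (Fin n) ≃L[ℝ] (Fin n → ℝ) × (Fin n → ℝ) :=
  LinearEquiv.toContinuousLinearEquiv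
    { toFun := fun x => (fun j => (inner ℂ (e j) x).re, fun j => (inner ℂ (e j) x).im)
      map_add' := fun x y => by
        ext j <;> simp
      map_smul' := fun c x => by
        have : ∀ j, inner ℂ (e j) (c • x) = (c : ℂ) * inner ℂ (e j) x := fun j => by
          rw [← Complex.coe_smul, inner_smul_right]
        ext j <;> simp [this]
      invFun := fun p => ∑ j, ((p.1 j : ℂ) + p.2 j * Complex.I) • e j
      left_inv := fun x => by
        simp only [Complex.re_add_im]
        exact e.sum_repr' x
      right_inv := fun p => by
        have : ∀ j, inner ℂ (e j) (∑ k, ((p.1 k : ℂ) + p.2 k * Complex.I) • e k) =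
            (p.1 j : ℂ) + p.2 j * Complex.I := fun j => e.orthonormal.inner_right_fintype _ j
        ext j <;> simp [this] }

variable {n : ℕ} (e : OrthonormalBasis (Fin n) ℂ (EuclideanSpace ℂ (Fin n)))

theorem frameEquiv_fst (x : EuclideanSpace ℂ (Fin n)) (j : Fin n) :
    (frameEquiv e x).1 j = (inner ℂ (e j) x).re := rfl

theorem frameEquiv_snd (x : EuclideanSpace ℂ (Fin n)) (j : Fin n) :
    (frameEquiv e x).2 j = (inner ℂ (e j) x).im := rfl

theorem inner_frameEquiv_symm (p : (Fin n → ℝ) × (Fin n → ℝ)) (j : Fin n) :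
    inner ℂ (e j) ((frameEquiv e).symm p) = (p.1 j : ℂ) + p.2 j * Complex.I :=
  e.orthonormal.inner_right_fintype _ j

/-- The derivative of a map with a special Lagrangian graph satisfies the special Lagrangian
condition. -/
theorem isSLDerivative_of_graph_mem {m : ℕ} {θ : ℝ}
    (e : OrthonormalBasis (Fin (m + 1)) ℂ (EuclideanSpace ℂ (Fin (m + 1))))
    (he : (Complex.exp (-(θ * Complex.I)) * Matrix.det (Matrix.of fun i j => e i j)).im = 0)
    {T : Submodule ℝ (EuclideanSpace ℂ (Fin (m + 1)))}
    (hT : ∀ u ∈ T, ∀ w ∈ T, (inner ℂ u w).im = 0)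
    (hT' : ∀ u : Fin (m + 1) → EuclideanSpace ℂ (Fin (m + 1)), (∀ i, u i ∈ T) →
      (Complex.exp (-(θ * Complex.I)) * Matrix.det (Matrix.of fun i j => u i j)).im = 0)
    {B : (Fin (m + 1) → ℝ) →L[ℝ] (Fin (m + 1) → ℝ)}
    (hB : ∀ v, (frameEquiv e).symm (v, B v) ∈ T) : IsSLDerivative B := by
  set u : Fin (m + 1) → EuclideanSpace ℂ (Fin (m + 1)) := fun j =>
    (frameEquiv e).symm (Pi.single j 1, B (Pi.single j 1)) with hu
  have hin : ∀ k j, inner ℂ (e k) (u j) = graphMatrix B k j := fun k j => by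
    rw [hu, inner_frameEquiv_symm, graphMatrix, Matrix.of_apply]
    by_cases hkj : k = j
    · subst hkj; simp [mul_comm]
    · simp [hkj, mul_comm]
  constructor
  · intro i j
    have h1 := hT (u i) (hB _) (u j) (hB _)
    rw [← e.sum_inner_mul_inner, Complex.im_sum] at h1
    have hterm : ∀ k, (inner ℂ (u i) (e k) * inner ℂ (e k) (u j)).im =
        (if k = i then B (Pi.single j 1) k else 0) -
          (if k = j then B (Pi.single i 1) k else 0) := by
      intro k
      rw [← inner_conj_symm, hin, hin, graphMatrix, Matrix.of_apply, Matrix.of_apply,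
        Matrix.one_apply, Matrix.one_apply]
      split_ifs <;> simp [sub_eq_add_neg]
    rw [Finset.sum_congr rfl fun k _ => hterm k, Finset.sum_sub_distrib,
      Finset.sum_ite_eq' Finset.univ i, Finset.sum_ite_eq' Finset.univ j,
      if_pos (Finset.mem_univ _), if_pos (Finset.mem_univ _)] at h1
    linarith
  · have h1 := hT' u fun i => hB _
    have hmul : (Matrix.of fun i j => u i j) =
        (graphMatrix B).transpose * (Matrix.of fun i j => e i j) := by
      ext i l
      have := congrArg (fun z : EuclideanSpace ℂ (Fin (m + 1)) => z l) (e.sum_repr' (u i))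
      simp only [hin] at this
      simpa [Matrix.mul_apply] using this.symm
    have hne : Matrix.det (Matrix.of fun i j => e i j) ≠ 0 := by
      rw [det_of_eq_basis_det]
      have := (Module.Basis.isUnit_det (EuclideanSpace.basisFun (Fin (m + 1)) ℂ).toBasis e.toBasis)
      rw [e.coe_toBasis] at this
      exact this.ne_zero
    set c := Complex.exp (-(θ * Complex.I)) * Matrix.det (Matrix.of fun i j => e i j) with hc
    have hc0 : c.re ≠ 0 := by
      intro h0
      exact mul_ne_zero (Complex.exp_ne_zero _) hne (Complex.ext h0 he)
    rw [hmul, Matrix.det_mul, Matrix.det_transpose, mul_left_comm, ← hc, Complex.mul_im, he,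
      mul_zero, zero_add] at h1
    exact (mul_eq_zero.1 h1).resolve_right hc0

/-- Riesz representation: a nonzero functional is a positive multiple of the inner product with the
last vector of a suitable orthonormal basis. -/
theorem exists_orthonormalBasis_last {F : Type*} [NormedAddCommGroup F] [InnerProductSpace ℝ F]
    [FiniteDimensional ℝ F] {m : ℕ} (hF : Module.finrank ℝ F = m + 1) {μ : F →L[ℝ] ℝ}
    (hμ : μ ≠ 0) : ∃ b : OrthonormalBasis (Fin (m + 1)) ℝ F,
      0 < μ (b (Fin.last m)) ∧ ∀ j, j ≠ Fin.last m → μ (b j) = 0 := by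
  let ν₀ : F := (InnerProductSpace.toDual ℝ F).symm μ
  have hν₀ : ∀ u : F, inner ℝ ν₀ u = μ u := fun u => InnerProductSpace.toDual_symm_apply
  have hν₀0 : ν₀ ≠ 0 := (LinearIsometryEquiv.map_eq_zero_iff _).not.2 hμ
  have hnorm : 0 < ‖ν₀‖ := norm_pos_iff.2 hν₀0
  let ν : F := ‖ν₀‖⁻¹ • ν₀
  have hν : ‖ν‖ = 1 := by
    rw [norm_smul, norm_inv, norm_norm, inv_mul_cancel₀ hnorm.ne']
  have hon : Orthonormal ℝ (({Fin.last m} : Set (Fin (m + 1))).domRestrict fun _ => ν) := by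
    refine ⟨fun i => hν, fun i j hij => ?_⟩
    exact absurd (Subtype.ext (i.2.trans j.2.symm)) hij
  obtain ⟨b, hb⟩ := hon.exists_orthonormalBasis_extension_of_card_eq (by rw [hF, Fintype.card_fin])
  have hbl : b (Fin.last m) = ν := hb _ rfl
  have hμb : ∀ j, μ (b j) = ‖ν₀‖ * inner ℝ (b (Fin.last m)) (b j) := by
    intro j
    have hs : inner ℝ ν (b j) = ‖ν₀‖⁻¹ * inner ℝ ν₀ (b j) := real_inner_smul_left _ _ _
    rw [← hν₀, hbl, hs, ← mul_assoc, mul_inv_cancel₀ hnorm.ne', one_mul]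
  have hbo := b.orthonormal
  rw [orthonormal_iff_ite] at hbo
  refine ⟨b, ?_, fun j hj => ?_⟩
  · rw [hμb, hbo, if_pos rfl, mul_one]
    exact hnorm
  · rw [hμb, hbo, if_neg hj.symm, mul_zero]

theorem exists_orthonormal_mem_last {F : Type*} [NormedAddCommGroup F] [InnerProductSpace ℝ F]
    {m : ℕ} {T : Submodule ℝ F} (hT : Module.finrank ℝ T = m + 1) {μ : F →L[ℝ] ℝ}
    (hμ : ∃ u ∈ T, μ u ≠ 0) : ∃ b : Fin (m + 1) → F, Orthonormal ℝ b ∧ (∀ j, b j ∈ T) ∧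
      0 < μ (b (Fin.last m)) ∧ ∀ j, j ≠ Fin.last m → μ (b j) = 0 := by
  have : FiniteDimensional ℝ T := Module.finite_of_finrank_pos (by omega)
  have hμT : μ.comp T.subtypeL ≠ 0 := by
    rintro h0
    obtain ⟨u, hu, hu0⟩ := hμ
    exact hu0 (DFunLike.congr_fun h0 ⟨u, hu⟩)
  obtain ⟨b, hb1, hb2⟩ := exists_orthonormalBasis_last hT hμT
  exact ⟨fun j => b j, b.orthonormal.comp_linearIsometry T.subtypeₗᵢ, fun j => (b j).2, hb1, hb2⟩

/-- The tangent plane at a boundary point lying in `P`, with boundary tangent to `P`, has a unitary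
basis consisting of tangent vectors of the boundary, which lie in `P`, and of a conormal, which is
orthogonal to `P`: as the tangent plane is isotropic, the conormal is orthogonal to the complex
span of the boundary directions, which is all of `P`. -/
theorem exists_adapted_frame {m : ℕ} {T : Submodule ℝ (EuclideanSpace ℂ (Fin (m + 1)))}
    (hTd : Module.finrank ℝ T = m + 1) (hT : ∀ u ∈ T, ∀ w ∈ T, (inner ℂ u w).im = 0)
    (μ : EuclideanSpace ℂ (Fin (m + 1)) →L[ℝ] ℝ) (hμ : ∃ u ∈ T, μ u ≠ 0)
    (P₀ : Submodule ℂ (EuclideanSpace ℂ (Fin (m + 1)))) (hP₀ : Module.finrank ℂ P₀ = m)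
    (hμP : ∀ u ∈ T, μ u = 0 → u ∈ P₀) :
    ∃ e : OrthonormalBasis (Fin (m + 1)) ℂ (EuclideanSpace ℂ (Fin (m + 1))),
      (∀ j, e j ∈ T) ∧ 0 < μ (e (Fin.last m)) ∧ (∀ j, j ≠ Fin.last m → e j ∈ P₀) ∧
      e (Fin.last m) ∈ P₀ᗮ := by
  obtain ⟨b, hbo, hbT, hb1, hb2⟩ := exists_orthonormal_mem_last hTd hμ
  rw [orthonormal_iff_ite] at hbo
  have hC : Orthonormal ℂ fun j => b j := by
    rw [orthonormal_iff_ite]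
    intro i j
    have h1 : (inner ℂ (b i) (b j)).re = if i = j then 1 else 0 := by
      rw [← real_inner_eq_re, ← hbo i j]
    refine Complex.ext ?_ ?_
    · rw [h1]; split_ifs <;> simp
    · rw [hT _ (hbT i) _ (hbT j)]; split_ifs <;> simp
  have hcard : Fintype.card (Fin (m + 1)) =
      Module.finrank ℂ (EuclideanSpace ℂ (Fin (m + 1))) := by simp
  let e := OrthonormalBasis.mk hC
    (hC.linearIndependent.span_eq_top_of_card_eq_finrank' hcard).ge
  have he : ∀ j, e j = b j := fun j => by simp [e]
  have hinit : ∀ j, j ≠ Fin.last m → e j ∈ P₀ := by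
    intro j hj
    rw [he]
    exact hμP _ (hbT j) (hb2 j hj)
  refine ⟨e, fun j => by rw [he]; exact (hbT j), ?_, hinit, ?_⟩
  · rw [he]
    exact hb1
  · let w : Fin m → EuclideanSpace ℂ (Fin (m + 1)) := fun j => e j.castSucc
    have hw : LinearIndependent ℂ w :=
      e.orthonormal.linearIndependent.comp _ (Fin.castSucc_injective m)
    have hle : Submodule.span ℂ (Set.range w) ≤ P₀ := by
      rw [Submodule.span_le]
      rintro _ ⟨j, rfl⟩
      exact hinit _ (Fin.castSucc_lt_last j).ne
    have heq := Submodule.eq_of_le_of_finrank_eq hle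
      (by rw [finrank_span_eq_card hw, hP₀, Fintype.card_fin])
    rw [← heq, Submodule.mem_orthogonal]
    intro u hu
    obtain ⟨c, rfl⟩ := (Submodule.mem_span_range_iff_exists_fun ℂ).1 hu
    rw [sum_inner]
    refine Finset.sum_eq_zero fun j _ => ?_
    rw [inner_smul_left, e.orthonormal.2 (Fin.castSucc_lt_last j).ne, mul_zero]

end Frames

/-! ### The reflection -/

section Reflection

variable {m : ℕ} {P : AffineSubspace ℂ (EuclideanSpace ℂ (Fin (m + 1)))} [Nonempty P]
  {f : EuclideanSpace ℂ (Fin (m + 1)) ≃ᵃⁱ[ℂ] EuclideanSpace ℂ (Fin (m + 1))}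

theorem linear_reflection_apply (hf : f = EuclideanGeometry.reflection P)
    (u : EuclideanSpace ℂ (Fin (m + 1))) :
    f.linearIsometryEquiv u = P.direction.reflection u := by
  let p : P := Classical.arbitrary P
  have h := f.map_vadd (p : EuclideanSpace ℂ (Fin (m + 1))) u
  have hp : f p = p := by
    rw [hf]
    exact EuclideanGeometry.reflection_eq_self_iff _ |>.2 p.2
  rw [hp] at h
  have h2 : f (u +ᵥ (p : EuclideanSpace ℂ (Fin (m + 1)))) =
      P.direction.reflection u +ᵥ (p : EuclideanSpace ℂ (Fin (m + 1))) := by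
    rw [hf, EuclideanGeometry.reflection_apply_of_mem P _ p.2]
    simp
  rw [h2] at h
  exact (vadd_right_cancel _ h).symm

theorem reflection_involutive (hf : f = EuclideanGeometry.reflection P) (x) : f (f x) = x := by
  rw [hf]
  exact EuclideanGeometry.reflection_reflection P x

theorem reflection_of_mem (hf : f = EuclideanGeometry.reflection P) {x} (hx : x ∈ P) :
    f x = x := by
  rw [hf]
  exact (EuclideanGeometry.reflection_eq_self_iff x).2 hx

/-- The reflection in a complex hyperplane changes the sign of the complex determinant, and hence
of the special Lagrangian form. -/
theorem slForm_reflection (hP : Module.finrank ℂ P.direction = m)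
    (hf : f = EuclideanGeometry.reflection P) (θ : ℝ)
    (v : Fin (m + 1) → EuclideanSpace ℂ (Fin (m + 1))) :
    slForm (m + 1) θ (fun i => f.linearIsometryEquiv (v i)) = -slForm (m + 1) θ v := by
  have hperp : Module.finrank ℂ P.directionᗮ = 1 := by
    have := P.direction.finrank_add_finrank_orthogonal
    rw [hP, finrank_euclideanSpace, Fintype.card_fin] at this
    omega
  rw [slForm_apply, slForm_apply, det_of_eq_basis_det, det_of_eq_basis_det]
  have hcomp : (fun i => f.linearIsometryEquiv (v i)) =
      (P.direction.reflection.toLinearEquiv : EuclideanSpace ℂ (Fin (m + 1)) →ₗ[ℂ] _) ∘ v := by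
    funext i
    exact linear_reflection_apply hf (v i)
  rw [hcomp, Module.Basis.det_comp, Submodule.det_reflection, hperp]
  simp

end Reflection

/-! ### Special Lagrangian submanifolds near a boundary point in a complex hyperplane -/

section LocalPicture

theorem finrank_tangentSpace_of_isOrientation {E : Type*} [NormedAddCommGroup E]
    [InnerProductSpace ℝ E] {d : ℕ} {M : Set E} {ξ : E → MultiVector E d}
    (h : IsOrientation M ξ) {x : E} (hx : x ∈ M) :
    Module.finrank ℝ (tangentSpace M x) = d := by
  obtain ⟨v, hv, hs, -⟩ := h.2 x hx
  rw [← hs, finrank_span_eq_card hv.linearIndependent, Fintype.card_fin]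

theorem IsSLSubmanifold.tangentSpace_calibrated {n : ℕ} {θ : ℝ}
    {S : Set (EuclideanSpace ℂ (Fin n))}
    {ξ : EuclideanSpace ℂ (Fin n) → MultiVector (EuclideanSpace ℂ (Fin n)) n}
    (hS : IsSLSubmanifold θ S ξ) {x : EuclideanSpace ℂ (Fin n)} (hx : x ∈ S) :
    (∀ u ∈ tangentSpace S x, ∀ w ∈ tangentSpace S x, (inner ℂ u w).im = 0) ∧
    ∀ u : Fin n → EuclideanSpace ℂ (Fin n), (∀ i, u i ∈ tangentSpace S x) →
      (Complex.exp (-(θ * Complex.I)) * Matrix.det (Matrix.of fun i j => u i j)).im = 0 := by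
  obtain ⟨v, hv, hs, hξ⟩ := hS.2.1.2 x hx
  have h1 := hS.2.2 x hx
  rw [hξ, wedge_apply] at h1
  rw [← hs]
  exact calibrated_span hv h1

theorem mem_tangentSpace_of_hasFDerivAt {X E : Type*} [NormedAddCommGroup X] [NormedSpace ℝ X]
    [NormedAddCommGroup E] [InnerProductSpace ℝ E] {γ : X → E} {D : X →L[ℝ] E} {y : X}
    (h : HasFDerivAt γ D y) {M : Set E} (hM : ∀ᶠ z in nhds y, γ z ∈ M) (v : X) :
    D v ∈ tangentSpace M (γ y) := by
  refine Submodule.subset_span ?_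
  have h1 := h.hasFDerivWithinAt (s := {z | γ z ∈ M})
  have h2 : v ∈ tangentConeAt ℝ {z | γ z ∈ M} y := by
    rw [tangentConeAt_of_mem_nhds hM]
    trivial
  refine tangentConeAt_mono ?_ (h1.mapsTo_tangent_cone h2)
  rintro _ ⟨z, hz, rfl⟩
  exact hz

variable {m : ℕ} {θ : ℝ} {S L W : Set (EuclideanSpace ℂ (Fin (m + 1)))}
  {ξ : EuclideanSpace ℂ (Fin (m + 1)) → MultiVector (EuclideanSpace ℂ (Fin (m + 1))) (m + 1)}
  {P : AffineSubspace ℂ (EuclideanSpace ℂ (Fin (m + 1)))} [Nonempty P]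
  {f : EuclideanSpace ℂ (Fin (m + 1)) ≃ᵃⁱ[ℂ] EuclideanSpace ℂ (Fin (m + 1))}

/-- In a frame adapted to `P` the reflection acts by changing the signs of the last coordinates. -/
theorem frameEquiv_reflection (hf : f = EuclideanGeometry.reflection P)
    (e : OrthonormalBasis (Fin (m + 1)) ℂ (EuclideanSpace ℂ (Fin (m + 1))))
    (he : ∀ j, j ≠ Fin.last m → e j ∈ P.direction) (hel : e (Fin.last m) ∈ P.directionᗮ)
    (u : EuclideanSpace ℂ (Fin (m + 1))) :
    frameEquiv e (f.linearIsometryEquiv u) =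
      (reflectLast m (frameEquiv e u).1, reflectLast m (frameEquiv e u).2) := by
  have hin : ∀ j, inner ℂ (e j) (f.linearIsometryEquiv u) =
      ((if j = Fin.last m then (-1 : ℝ) else 1 : ℝ) : ℂ) * inner ℂ (e j) u := by
    intro j
    have hR : ∀ w, f.linearIsometryEquiv w = P.direction.reflection w :=
      linear_reflection_apply hf
    have h1 : inner ℂ (e j) (f.linearIsometryEquiv u) =
        inner ℂ (f.linearIsometryEquiv (e j)) u := by
      rw [hR, hR, ← LinearIsometryEquiv.inner_map_map P.direction.reflection (e j),
        Submodule.reflection_reflection]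
    rw [h1, hR]
    split_ifs with hj
    · subst hj
      rw [Submodule.reflection_mem_subspace_orthogonalComplement_eq_neg hel, inner_neg_left]
      simp
    · rw [Submodule.reflection_mem_subspace_eq_self (he j hj)]
      simp
  refine Prod.ext (funext fun j => ?_) (funext fun j => ?_)
  · rw [frameEquiv_fst, hin, Complex.re_ofReal_mul]
    rfl
  · rw [frameEquiv_snd, hin, Complex.im_ofReal_mul]
    rfl

/-- Near a point `x₀` of `L`, in suitable real coordinates `(a, b)`, the submanifold `S` is the
graph `b = g a` over a half space, and `g` continues smoothly by reflection. -/
theorem exists_local_graph (hS : IsSLSubmanifold θ S ξ)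
    (hP : Module.finrank ℂ P.direction = m) (hW : IsOpen W)
    (hL : L = boundary (m + 1) S ∩ W) (hLP : L ⊆ P)
    (hf : f = EuclideanGeometry.reflection P) {x₀ : EuclideanSpace ℂ (Fin (m + 1))}
    (hx₀ : x₀ ∈ L) :
    ∃ (κ : EuclideanSpace ℂ (Fin (m + 1)) ≃L[ℝ] (Fin (m + 1) → ℝ) × (Fin (m + 1) → ℝ))
      (Ω : Set (Fin (m + 1) → ℝ)) (g : (Fin (m + 1) → ℝ) → (Fin (m + 1) → ℝ))
      (U : Set (EuclideanSpace ℂ (Fin (m + 1)))), IsOpen U ∧ x₀ ∈ U ∧ IsOpen Ω ∧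
      (∀ u, κ (f.linearIsometryEquiv u) = (reflectLast m (κ u).1, reflectLast m (κ u).2)) ∧
      (∀ x ∈ U, (κ (x - x₀)).1 ∈ Ω ∧ (x ∈ S ↔
        (κ (x - x₀)).2 = g (κ (x - x₀)).1 ∧ 0 ≤ lastCoord m (κ (x - x₀)).1)) ∧
      (∀ y ∈ Ω, lastCoord m y = 0 → g y = reflectLast m (g (reflectLast m y))) ∧
      ContDiffOn ℝ ∞ (glue (lastCoord m) g fun y => reflectLast m (g (reflectLast m y))) Ω := by
  have hx₀b : IsBoundaryPoint (m + 1) S x₀ := (hL ▸ hx₀).1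
  have hx₀W : x₀ ∈ W := (hL ▸ hx₀).2
  obtain ⟨hx₀S, Φ, V, ℓ, hxs, h1, h2, hV, ⟨v₀, hv₀, hℓv₀⟩, hℓx, hI⟩ := hx₀b
  rw [image_inter_source_eq_iff] at hI
  have hxV : Φ x₀ ∈ V := ((hI x₀ hxs).1 hx₀S).1
  -- points of the face `ℓ = 0` near `x₀` are boundary points, hence lie in `P`
  have hface : ∀ z ∈ Φ.source, z ∈ W → Φ z ∈ V → ℓ (Φ z) = 0 → z ∈ P := by
    intro z hz hzW hzV hzℓ
    refine hLP (hL ▸ ⟨?_, hzW⟩)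
    refine ⟨(hI z hz).2 ⟨hzV, hzℓ.ge⟩, Φ, V, ℓ, hz, h1, h2, hV, ⟨v₀, hv₀, hℓv₀⟩, hzℓ, ?_⟩
    rw [image_inter_source_eq_iff]
    exact hI
  obtain ⟨A, hA, hA'⟩ := exists_equiv_hasFDerivAt h1 h2 hxs
  -- the tangent space at `x₀`
  set T : Submodule ℝ (EuclideanSpace ℂ (Fin (m + 1))) :=
    V.comap ((A : EuclideanSpace ℂ (Fin (m + 1)) →L[ℝ] EuclideanSpace ℂ (Fin (m + 1))) :
      EuclideanSpace ℂ (Fin (m + 1)) →ₗ[ℝ] EuclideanSpace ℂ (Fin (m + 1))) with hTdef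
  have hTmem : ∀ u, u ∈ T ↔ A u ∈ V := fun u => Iff.rfl
  have hTd : Module.finrank ℝ T = m + 1 := by rw [hTdef, finrank_comap_equiv, hV]
  have hTS : tangentSpace S x₀ = T :=
    Submodule.eq_of_le_of_finrank_eq
      (tangentSpace_le_comap hxs hA V hxV fun y hy hyS => ((hI y hy).1 hyS).1)
      (by rw [finrank_tangentSpace_of_isOrientation hS.2.1 hx₀S, hTd])
  obtain ⟨hTi, hTd'⟩ := hS.tangentSpace_calibrated hx₀S
  rw [hTS] at hTi hTd'
  obtain ⟨e, heT, hel, hein, heo⟩ := exists_adapted_frame hTd hTi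
    (ℓ.comp (A : EuclideanSpace ℂ (Fin (m + 1)) →L[ℝ] EuclideanSpace ℂ (Fin (m + 1))))
    ⟨A.symm v₀, by simpa [hTmem] using hv₀, by simpa using hℓv₀⟩ P.direction hP (by
      intro u hu hu0
      let c : ℝ → EuclideanSpace ℂ (Fin (m + 1)) := fun s => Φ.symm (Φ x₀ + s • A u)
      have hline : HasDerivAt (fun s : ℝ => Φ x₀ + s • A u) (A u) 0 := by
        simpa using ((hasDerivAt_id (0 : ℝ)).smul_const (A u)).const_add (Φ x₀)
      have hc0 : c 0 = x₀ := by simp [c, Φ.left_inv hxs]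
      have hc : HasDerivAt c u 0 := by
        have h3 : HasFDerivAt Φ.symm (A.symm : EuclideanSpace ℂ (Fin (m + 1)) →L[ℝ]
            EuclideanSpace ℂ (Fin (m + 1)))
            (Φ x₀ + (0 : ℝ) • A u) := by simpa using hA'
        exact (h3.comp_hasDerivAt (0 : ℝ) hline).congr_deriv (A.symm_apply_apply u)
      have e1 : ∀ᶠ s in nhds (0 : ℝ), Φ x₀ + s • A u ∈ Φ.target :=
        hline.continuousAt (Φ.open_target.mem_nhds (by simpa using Φ.map_source hxs))
      have e2 : ∀ᶠ s in nhds (0 : ℝ), c s ∈ W :=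
        hc.continuousAt (hW.mem_nhds (by rwa [hc0]))
      refine deriv_mem_of_eventually_mem (P.direction.restrictScalars ℝ) hc ?_
      filter_upwards [e1, e2] with s hs1 hs2
      rw [hc0]
      have hℓ0 : ℓ (A u) = 0 := hu0
      refine P.vsub_mem_direction (hface (c s) (Φ.map_target hs1) hs2 ?_ ?_) (hLP hx₀)
      · rw [Φ.right_inv hs1]
        exact V.add_mem hxV (V.smul_mem _ hu)
      · rw [Φ.right_inv hs1, map_add, map_smul, hℓx, hℓ0, smul_zero, add_zero])
  have hdet := hTd' (fun j => e j) heT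
  set κ := frameEquiv e with hκ
  let X := Fin (m + 1) → ℝ
  let a : EuclideanSpace ℂ (Fin (m + 1)) →L[ℝ] X :=
    (ContinuousLinearMap.fst ℝ X X).comp (κ : EuclideanSpace ℂ (Fin (m + 1)) →L[ℝ] X × X)
  let b : EuclideanSpace ℂ (Fin (m + 1)) →L[ℝ] X :=
    (ContinuousLinearMap.snd ℝ X X).comp (κ : EuclideanSpace ℂ (Fin (m + 1)) →L[ℝ] X × X)
  have hκab : ∀ u, κ u = (a u, b u) := fun u => rfl
  have hbT : ∀ u ∈ T, b u = 0 := fun u hu => funext fun j => hTi _ (heT j) u hu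
  obtain ⟨U, Ω, γ, hUo, hxU, hUs, hΩo, h0Ω, hγ, hγΩ, hUγ⟩ :=
    exists_parametrization (X := X) (by rw [finrank_real_euclideanSpace]; simp [X]) h1
      (by rw [hV]; simp [X]) hxs hxV hA a (by
        intro u hu hau
        have : κ u = 0 := by rw [hκab, hau, hbT u hu]; rfl
        simpa using this)
  have hγ0 : γ 0 = x₀ := by simpa using (hUγ x₀ hxU hxV).2
  let g : X → X := fun y => b (γ y - x₀)
  have hg : ContDiffOn ℝ ∞ g Ω := b.contDiff.comp_contDiffOn (hγ.sub contDiffOn_const)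
  have hκγ : ∀ y ∈ Ω, κ (γ y - x₀) = (y, g y) := fun y hy => by rw [hκab, (hγΩ y hy).2.1]
  have hγd : ∀ y ∈ Ω, HasFDerivAt γ (fderiv ℝ γ y) y := fun y hy =>
    (differentiableAt_of_contDiffOn hΩo hγ hy).hasFDerivAt
  have hgd : ∀ y ∈ Ω, fderiv ℝ g y = b.comp (fderiv ℝ γ y) := fun y hy =>
    (b.hasFDerivAt.comp y ((hγd y hy).sub_const x₀)).fderiv
  have had : ∀ y ∈ Ω, ∀ v, a (fderiv ℝ γ y v) = v := by
    intro y hy v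
    have e1 := a.hasFDerivAt.comp y ((hγd y hy).sub_const x₀)
    have e2 : (a ∘ fun y => γ y - x₀) =ᶠ[nhds y] id := by
      filter_upwards [hΩo.mem_nhds hy] with z hz using (hγΩ z hz).2.1
    exact DFunLike.congr_fun ((e1.congr_of_eventuallyEq e2.symm).unique (hasFDerivAt_id y)) v
  have hκd : ∀ y ∈ Ω, ∀ v, κ (fderiv ℝ γ y v) = (v, fderiv ℝ g y v) := fun y hy v => by
    rw [hκab, had y hy, hgd y hy]; rfl
  -- at the origin the parametrization is tangent to `T`
  have hγ0T : ∀ v, fderiv ℝ γ 0 v ∈ T := by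
    intro v
    have hline : HasDerivAt (fun s : ℝ => s • v) v 0 := by
      simpa using (hasDerivAt_id (0 : ℝ)).smul_const v
    have e1 : HasFDerivAt γ (fderiv ℝ γ 0) ((0 : ℝ) • v) := by simpa using hγd 0 h0Ω
    have e2 := e1.comp_hasDerivAt (0 : ℝ) hline
    have e3 : HasFDerivAt Φ (A : EuclideanSpace ℂ (Fin (m + 1)) →L[ℝ]
        EuclideanSpace ℂ (Fin (m + 1)))
        ((γ ∘ fun s : ℝ => s • v) 0) := by simpa [hγ0] using hA
    refine deriv_mem_of_eventually_mem V (e3.comp_hasDerivAt (0 : ℝ) e2) ?_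
    filter_upwards [hline.continuousAt (hΩo.mem_nhds (by simpa using h0Ω))] with s hs
    refine V.sub_mem (hγΩ _ hs).2.2 ?_
    simpa [hγ0] using hxV
  have hg0 : fderiv ℝ g 0 = 0 := by
    ext v : 1
    rw [hgd 0 h0Ω]
    exact hbT _ (hγ0T v)
  let ν : X := Pi.single (Fin.last m) 1
  have hν : fderiv ℝ γ 0 ν = e (Fin.last m) := by
    apply κ.injective
    rw [hκd 0 h0Ω, hg0]
    refine Prod.ext (funext fun j => ?_) (hbT _ (heT _)).symm
    rw [hκ, frameEquiv_fst, orthonormal_iff_ite.1 e.orthonormal]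
    by_cases hj : j = Fin.last m
    · simp [ν, hj]
    · simp [ν, hj]
  -- the sign of the defining function `ℓ`
  let lam : X → ℝ := fun y => ℓ (Φ (γ y))
  have hlam : ContDiffOn ℝ ∞ lam Ω :=
    ℓ.contDiff.comp_contDiffOn (h1.comp hγ fun y hy => hUs (hγΩ y hy).1)
  have hlamd : fderiv ℝ lam 0 ν = ℓ (A (e (Fin.last m))) := by
    have e3 : HasFDerivAt Φ (A : EuclideanSpace ℂ (Fin (m + 1)) →L[ℝ]
        EuclideanSpace ℂ (Fin (m + 1))) (γ 0) := by
      rwa [hγ0]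
    have := (ℓ.hasFDerivAt.comp (0 : X) (e3.comp (0 : X) (hγd 0 h0Ω))).fderiv
    change fderiv ℝ (ℓ ∘ Φ ∘ γ) 0 ν = _
    rw [this, ← hν]
    rfl
  have hΩ₁ : IsOpen (Ω ∩ γ ⁻¹' W) := hγ.continuousOn.isOpen_inter_preimage hΩo hW
  have hzP : ∀ y ∈ Ω ∩ γ ⁻¹' W, lam y = 0 → y (Fin.last m) = 0 ∧ g y (Fin.last m) = 0 := by
    intro y hy hly
    have hyP := hface (γ y) (hUs (hγΩ y hy.1).1) hy.2 (hγΩ y hy.1).2.2 hly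
    have hdir : γ y - x₀ ∈ P.direction := P.vsub_mem_direction hyP (hLP hx₀)
    have h0 : inner ℂ (e (Fin.last m)) (γ y - x₀) = 0 :=
      (Submodule.mem_orthogonal' _ _).1 heo _ hdir
    have h3 := hκγ y hy.1
    have h4 : (κ (γ y - x₀)).1 (Fin.last m) = y (Fin.last m) := by rw [h3]
    have h5 : (κ (γ y - x₀)).2 (Fin.last m) = g y (Fin.last m) := by rw [h3]
    rw [hκ, frameEquiv_fst, h0] at h4
    rw [hκ, frameEquiv_snd, h0] at h5
    exact ⟨h4.symm, h5.symm⟩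
  obtain ⟨ε, hε, hball, hsign⟩ := exists_ball_sign hΩ₁ ⟨h0Ω, by simpa [hγ0] using hx₀W⟩
    (hlam.mono Set.inter_subset_left) (by simp only [lam, hγ0, hℓx])
    (by rw [hlamd]; exact hel) fun y hy hly => (hzP y hy hly).1
  -- the equation can be solved for the normal derivative near the origin
  have hgc : ContinuousAt (fderiv ℝ g) 0 :=
    (contDiffOn_fderiv hΩo hg).continuousOn.continuousAt (hΩo.mem_nhds h0Ω)
  have hnc : Continuous fun B : X →L[ℝ] X => (normalCoeff B).re :=
    Complex.continuous_re.comp contDiff_normalCoeff.continuous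
  have hn1 : ∀ᶠ y in nhds (0 : X), (normalCoeff ((fderiv ℝ g y).comp (projInit m))).re ≠ 0 := by
    have hc : ContinuousAt (fun y => (normalCoeff ((fderiv ℝ g y).comp (projInit m))).re) 0 :=
      hnc.continuousAt.comp (f := fun y => (fderiv ℝ g y).comp (projInit m))
        (hgc.clm_comp continuousAt_const)
    refine hc.eventually_ne ?_
    rw [hg0, ContinuousLinearMap.zero_comp, normalCoeff_zero]
    exact one_ne_zero
  have hn2 : ∀ᶠ y in nhds (0 : X), (normalCoeff (((reflectLast m).comp
      ((fderiv ℝ g (reflectLast m y)).comp (reflectLast m))).comp (projInit m))).re ≠ 0 := by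
    have hgc' : ContinuousAt (fun y => fderiv ℝ g (reflectLast m y)) 0 := by
      refine ContinuousAt.comp (f := reflectLast m) ?_ (reflectLast m).continuous.continuousAt
      simpa using hgc
    have hc : ContinuousAt (fun y => (normalCoeff (((reflectLast m).comp
        ((fderiv ℝ g (reflectLast m y)).comp (reflectLast m))).comp (projInit m))).re) 0 :=
      hnc.continuousAt.comp (f := fun y => ((reflectLast m).comp
        ((fderiv ℝ g (reflectLast m y)).comp (reflectLast m))).comp (projInit m))
        ((continuousAt_const.clm_comp (hgc'.clm_comp continuousAt_const)).clm_comp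
          continuousAt_const)
    refine hc.eventually_ne ?_
    rw [map_zero, hg0, ContinuousLinearMap.zero_comp, ContinuousLinearMap.comp_zero,
      ContinuousLinearMap.zero_comp, normalCoeff_zero]
    exact one_ne_zero
  obtain ⟨r, hr, hballr⟩ := Metric.mem_nhds_iff.1
    (Filter.inter_mem (hn1.and hn2) (Metric.ball_mem_nhds (0 : X) hε))
  have hrΩ : ∀ y ∈ Metric.ball (0 : X) r, y ∈ Ω ∩ γ ⁻¹' W := fun y hy => hball (hballr hy).2
  have hmemS : ∀ y ∈ Metric.ball (0 : X) r, (γ y ∈ S ↔ 0 ≤ lastCoord m y) := by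
    intro y hy
    rw [hI _ (hUs (hγΩ y (hrΩ y hy).1).1), lastCoord_apply, ← (hsign y (hballr hy).2).1]
    exact ⟨fun h => h.2, fun h => ⟨(hγΩ y (hrΩ y hy).1).2.2, h⟩⟩
  have hglue := contDiffOn_glue_reflect (m := m) Metric.isOpen_ball
    (fun y hy => by rwa [mem_ball_zero_iff, norm_reflectLast, ← mem_ball_zero_iff])
    (hg.mono fun y hy => (hrΩ y hy).1) (fun y hy => (hballr hy).1.1)
    (fun y hy => (hballr hy).1.2) (by
      intro y hy hty
      have hyS := (hmemS y hy).2 hty.le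
      obtain ⟨hi, hd⟩ := hS.tangentSpace_calibrated hyS
      refine isSLDerivative_of_graph_mem e hdet hi hd fun v => ?_
      have hv : (frameEquiv e).symm (v, fderiv ℝ g y v) = fderiv ℝ γ y v := by
        rw [ContinuousLinearEquiv.symm_apply_eq]
        exact (hκd y (hrΩ y hy).1 v).symm
      rw [hv]
      refine mem_tangentSpace_of_hasFDerivAt (hγd y (hrΩ y hy).1) ?_ v
      filter_upwards [Metric.isOpen_ball.mem_nhds hy,
        (isOpen_lt continuous_const (lastCoord m).continuous).mem_nhds hty] with z hz hz'
      exact (hmemS z hz).2 (le_of_lt hz'))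
    fun y hy hty => (hzP y (hrΩ y hy) ((hsign y (hballr hy).2).2.2 hty)).2
  have hac : Continuous fun x => a (x - x₀) :=
    a.continuous.comp (continuous_id.sub continuous_const)
  refine ⟨κ, Metric.ball 0 r, g, U ∩ (fun x => a (x - x₀)) ⁻¹' Metric.ball 0 r,
    hUo.inter (Metric.isOpen_ball.preimage hac), ⟨hxU, by simpa using hr⟩, Metric.isOpen_ball,
    frameEquiv_reflection hf e hein heo, fun x hx => ⟨hx.2, ?_⟩, hglue.1, hglue.2⟩
  constructor
  · intro hxS
    have hxV := ((hI x (hUs hx.1)).1 hxS).1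
    have hγx := (hUγ x hx.1 hxV).2
    have hxΩ := (hUγ x hx.1 hxV).1
    refine ⟨?_, ?_⟩
    · have := hκγ _ hxΩ
      rw [hγx] at this
      have h5 : (κ (x - x₀)).2 = g (a (x - x₀)) := by rw [this]
      exact h5
    · refine (hmemS _ hx.2).1 ?_
      beta_reduce
      rwa [hγx]
  · rintro ⟨hb, ht⟩
    have hγS := (hmemS _ hx.2).2 ht
    have : γ (a (x - x₀)) = x := by
      have h3 := hκγ _ (hrΩ _ hx.2).1
      have h4 : κ (γ (a (x - x₀)) - x₀) = κ (x - x₀) := by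
        rw [h3, hκab (x - x₀)]
        exact Prod.ext rfl hb.symm
      simpa using κ.injective h4
    rw [← this]
    exact hγS

end LocalPicture

/-! ### The reflected submanifold and the union -/

section Union

variable {m : ℕ} {θ : ℝ} {S L W : Set (EuclideanSpace ℂ (Fin (m + 1)))}
  {ξ : EuclideanSpace ℂ (Fin (m + 1)) → MultiVector (EuclideanSpace ℂ (Fin (m + 1))) (m + 1)}
  {P : AffineSubspace ℂ (EuclideanSpace ℂ (Fin (m + 1)))} [Nonempty P]
  {f : EuclideanSpace ℂ (Fin (m + 1)) ≃ᵃⁱ[ℂ] EuclideanSpace ℂ (Fin (m + 1))}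

/-- Continuity of the negation is derived from the operator norm on multivectors: instance search
finds no `ContinuousNeg` for the strong topology on the dual of the alternating forms. -/
theorem continuousOn_neg_multiVector {E X : Type*} [NormedAddCommGroup E] [InnerProductSpace ℝ E]
    [TopologicalSpace X] {d : ℕ} {A : Set X} {η : X → MultiVector E d} (h : ContinuousOn η A) :
    ContinuousOn (-η) A :=
  ((SeminormedAddCommGroup.toIsTopologicalAddGroup
    (E := (E [⋀^Fin d]→L[ℝ] ℝ) →L[ℝ] ℝ)).continuous_neg).comp_continuousOn h

theorem contDiff_affineIsometryEquiv
    (f : EuclideanSpace ℂ (Fin (m + 1)) ≃ᵃⁱ[ℂ] EuclideanSpace ℂ (Fin (m + 1))) :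
    ContDiff ℝ ∞ f :=
  (f.toContinuousAffineEquiv.toContinuousAffineMap.contDiff (n := ∞)).restrict_scalars ℝ

/-- The linear part of an affine isometry, as a real linear equivalence. -/
def realLinear (f : EuclideanSpace ℂ (Fin (m + 1)) ≃ᵃⁱ[ℂ] EuclideanSpace ℂ (Fin (m + 1))) :
    EuclideanSpace ℂ (Fin (m + 1)) ≃L[ℝ] EuclideanSpace ℂ (Fin (m + 1)) :=
  f.linearIsometryEquiv.toContinuousLinearEquiv.restrictScalars ℝ

theorem hasFDerivAt_affineIsometryEquiv
    (f : EuclideanSpace ℂ (Fin (m + 1)) ≃ᵃⁱ[ℂ] EuclideanSpace ℂ (Fin (m + 1)))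
    (x : EuclideanSpace ℂ (Fin (m + 1))) :
    HasFDerivAt f (realLinear f : EuclideanSpace ℂ (Fin (m + 1)) →L[ℝ]
      EuclideanSpace ℂ (Fin (m + 1))) x := by
  have h : ∀ y, f y = realLinear f y + (f x - realLinear f x) := fun y => by
    have h1 : realLinear f (y - x) = f y - f x := f.map_vsub y x
    rw [map_sub] at h1
    rw [add_sub_left_comm, h1]
    abel
  have h2 := ((realLinear f).hasFDerivAt (x := x)).add_const (f x - realLinear f x)
  exact h2.congr_of_eventuallyEq (Filter.Eventually.of_forall h)

theorem tangentSpace_image_affineIsometryEquiv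
    (f : EuclideanSpace ℂ (Fin (m + 1)) ≃ᵃⁱ[ℂ] EuclideanSpace ℂ (Fin (m + 1)))
    (x : EuclideanSpace ℂ (Fin (m + 1))) :
    tangentSpace (f '' S) (f x) = (tangentSpace S x).map
      ((realLinear f : EuclideanSpace ℂ (Fin (m + 1)) →L[ℝ] EuclideanSpace ℂ (Fin (m + 1))) :
        EuclideanSpace ℂ (Fin (m + 1)) →ₗ[ℝ] EuclideanSpace ℂ (Fin (m + 1))) :=
  tangentSpace_image f.toHomeomorph (realLinear f) (hasFDerivAt_affineIsometryEquiv f x)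
    (hasFDerivAt_affineIsometryEquiv f.symm (f x))

theorem pushforward_apply {d : ℕ}
    {ξ : EuclideanSpace ℂ (Fin (m + 1)) → MultiVector (EuclideanSpace ℂ (Fin (m + 1))) d}
    {x : EuclideanSpace ℂ (Fin (m + 1))} {v : Fin d → EuclideanSpace ℂ (Fin (m + 1))}
    (h : ξ x = wedge v) : pushforward f ξ (f x) = wedge fun i => realLinear f (v i) := by
  rw [pushforward, f.symm_apply_apply, h]
  rfl

theorem orthonormal_realLinear {d : ℕ} {v : Fin d → EuclideanSpace ℂ (Fin (m + 1))}
    (hv : Orthonormal ℝ v) : Orthonormal ℝ fun i => realLinear f (v i) := by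
  rw [orthonormal_iff_ite] at hv ⊢
  intro i j
  rw [← hv i j, real_inner_eq_re, real_inner_eq_re]
  exact congrArg Complex.re (f.linearIsometryEquiv.inner_map_map (v i) (v j))

/-- The reflected submanifold, with reversed orientation, is special Lagrangian: the reflection
changes the sign of the special Lagrangian form. -/
theorem IsSLSubmanifold.reflect (hS : IsSLSubmanifold θ S ξ)
    (hP : Module.finrank ℂ P.direction = m) (hf : f = EuclideanGeometry.reflection P) :
    IsSLSubmanifold θ (f '' S) (-pushforward f ξ) := by
  have hframe : ∀ x ∈ S, ∃ v : Fin (m + 1) → EuclideanSpace ℂ (Fin (m + 1)), Orthonormal ℝ v ∧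
      Submodule.span ℝ (Set.range v) = tangentSpace S x ∧ slForm (m + 1) θ v = 1 ∧
      pushforward f ξ (f x) = wedge fun i => realLinear f (v i) := by
    intro x hx
    obtain ⟨v, hv, hs, hξ⟩ := hS.2.1.2 x hx
    have h1 := hS.2.2 x hx
    rw [hξ, wedge_apply] at h1
    exact ⟨v, hv, hs, h1, pushforward_apply hξ⟩
  refine ⟨?_, ⟨?_, ?_⟩, ?_⟩
  · rintro _ ⟨x, hx, rfl⟩
    have hf1 := contDiff_affineIsometryEquiv f
    have hf2 := contDiff_affineIsometryEquiv f.symm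
    exact (hS.1 x hx).imp (fun h => h.image f.toHomeomorph hf1 hf2)
      fun h => h.image f.toHomeomorph hf1 hf2
  · have hmap : Continuous fun η : MultiVector (EuclideanSpace ℂ (Fin (m + 1))) (m + 1) =>
        η.map (realLinear f : EuclideanSpace ℂ (Fin (m + 1)) →L[ℝ]
          EuclideanSpace ℂ (Fin (m + 1))) := by
      unfold MultiVector.map
      fun_prop
    refine continuousOn_neg_multiVector ?_
    refine hmap.comp_continuousOn (hS.2.1.1.comp f.symm.continuous.continuousOn ?_)
    rintro _ ⟨x, hx, rfl⟩
    rwa [f.symm_apply_apply]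
  · rintro _ ⟨x, hx, rfl⟩
    obtain ⟨v, hv, hs, h1, hpf⟩ := hframe x hx
    refine ⟨_, orthonormal_update_neg (orthonormal_realLinear (f := f) hv), ?_, ?_⟩
    · rw [span_update_neg, tangentSpace_image_affineIsometryEquiv, ← hs, Submodule.map_span,
        ← Set.range_comp]
      rfl
    · rw [Pi.neg_apply, hpf, neg_wedge]
  · rintro _ ⟨x, hx, rfl⟩
    obtain ⟨v, hv, hs, h1, hpf⟩ := hframe x hx
    rw [Pi.neg_apply, hpf, neg_apply, wedge_apply]
    have := slForm_reflection hP hf θ v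
    rw [h1] at this
    rw [neg_eq_iff_eq_neg]
    exact this

theorem mem_image_reflection (hf : f = EuclideanGeometry.reflection P)
    {A : Set (EuclideanSpace ℂ (Fin (m + 1)))} {x : EuclideanSpace ℂ (Fin (m + 1))} :
    x ∈ f '' A ↔ f x ∈ A := by
  constructor
  · rintro ⟨y, hy, rfl⟩
    rwa [reflection_involutive hf]
  · intro h
    exact ⟨f x, h, reflection_involutive hf x⟩

/-- Near each point of `L` the union is a submanifold without boundary, of which both pieces are
relatively closed subsets. -/
theorem exists_nhds_union (hS : IsSLSubmanifold θ S ξ)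
    (hP : Module.finrank ℂ P.direction = m) (hW : IsOpen W)
    (hL : L = boundary (m + 1) S ∩ W) (hLP : L ⊆ P)
    (hf : f = EuclideanGeometry.reflection P) {x₀ : EuclideanSpace ℂ (Fin (m + 1))}
    (hx₀ : x₀ ∈ L) :
    ∃ U, IsOpen U ∧ x₀ ∈ U ∧
      (∀ y ∈ U, y ∈ S ∪ f '' S → IsInteriorPoint (m + 1) (S ∪ f '' S) y) ∧
      closure S ∩ U ⊆ S ∧ closure (f '' S) ∩ U ⊆ f '' S := by
  have hx₀b : IsBoundaryPoint (m + 1) S x₀ := (hL ▸ hx₀).1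
  obtain ⟨κ, Ω, g, U, hUo, hxU, hΩ, hκ, hUS, hgl, hG⟩ :=
    exists_local_graph hS hP hW hL hLP hf hx₀
  obtain ⟨U₁, hU₁, hxU₁, hcl⟩ := hx₀b.exists_closure_inter_subset
  have hfx₀ : f x₀ = x₀ := reflection_of_mem hf (hLP hx₀)
  have hUo' : IsOpen (U ∩ U₁) := hUo.inter hU₁
  refine ⟨(U ∩ U₁) ∩ f ⁻¹' (U ∩ U₁), hUo'.inter (hUo'.preimage f.continuous),
    ⟨⟨hxU, hxU₁⟩, by rw [Set.mem_preimage, hfx₀]; exact ⟨hxU, hxU₁⟩⟩, ?_,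
    fun y hy => hcl ⟨hy.1, hy.2.1.2⟩, ?_⟩
  · intro y hyU hy
    refine isInteriorPoint_of_graph (by simp) κ x₀ hΩ hG
      (hUo'.inter (hUo'.preimage f.continuous)) (fun x hx => (hUS x hx.1.1).1) ?_ hyU hy
    intro x hx
    have h1 := (hUS x hx.1.1).2
    have h2 := (hUS (f x) hx.2.1).2
    have hR : f x - x₀ = f.linearIsometryEquiv (x - x₀) := by
      have := f.map_vsub x x₀
      rw [hfx₀] at this
      exact this.symm
    have hxΩ := (hUS x hx.1.1).1
    rw [hR, hκ, lastCoord_reflectLast] at h2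
    set a := (κ (x - x₀)).1
    set b := (κ (x - x₀)).2
    rw [Set.mem_union, mem_image_reflection hf, h1, h2, glue]
    have hb : reflectLast m b = g (reflectLast m a) ↔ b = reflectLast m (g (reflectLast m a)) := by
      constructor
      · intro h
        rw [← h, reflectLast_reflectLast]
      · intro h
        rw [h, reflectLast_reflectLast]
    rw [hb]
    split_ifs with hta
    · constructor
      · rintro (h | ⟨h, ht⟩)
        · exact h.1
        · rw [h, hgl a hxΩ (le_antisymm (by linarith) hta)]
      · exact fun h => Or.inl ⟨h, hta⟩
    · constructor
      · rintro (h | h)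
        · exact absurd h.2 hta
        · exact h.1
      · exact fun h => Or.inr ⟨h, by linarith⟩
  · rintro y ⟨hy, hyU⟩
    rw [mem_image_reflection hf]
    refine hcl ⟨?_, hyU.2.2⟩
    have h1 : closure (f '' S) = f '' closure S := (f.toHomeomorph.image_closure S).symm
    rw [h1, mem_image_reflection hf] at hy
    exact hy

theorem unionOrientation_of_mem {y : EuclideanSpace ℂ (Fin (m + 1))} (hy : y ∈ S) :
    unionOrientation f S ξ y = ξ y := if_pos hy

theorem unionOrientation_of_notMem {y : EuclideanSpace ℂ (Fin (m + 1))} (hy : y ∉ S) :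
    unionOrientation f S ξ y = (-pushforward f ξ) y := if_neg hy

theorem tangentSpace_eq_of_isInteriorPoint {E : Type*} [NormedAddCommGroup E]
    [InnerProductSpace ℝ E] [FiniteDimensional ℝ E] {d : ℕ} {M N : Set E}
    {η : E → MultiVector E d} (hM : IsOrientation M η) {y : E} (hy : y ∈ M) (hMN : M ⊆ N)
    (hN : IsInteriorPoint d N y) : tangentSpace M y = tangentSpace N y :=
  Submodule.eq_of_le_of_finrank_le (tangentSpace_mono hMN y)
    (by rw [finrank_tangentSpace_of_isOrientation hM hy]; exact hN.finrank_tangentSpace_le)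

/-- At common points at which the union is a submanifold the two orientations agree: the tangent
planes coincide, and both orientations are calibrated. -/
theorem orientation_eq_of_mem_inter (hS : IsSLSubmanifold θ S ξ)
    (hS' : IsSLSubmanifold θ (f '' S) (-pushforward f ξ)) {y : EuclideanSpace ℂ (Fin (m + 1))}
    (hy : y ∈ S) (hy' : y ∈ f '' S) (hi : IsInteriorPoint (m + 1) (S ∪ f '' S) y) :
    ξ y = (-pushforward f ξ) y := by
  have t1 := tangentSpace_eq_of_isInteriorPoint hS.2.1 hy Set.subset_union_left hi
  have t2 := tangentSpace_eq_of_isInteriorPoint hS'.2.1 hy' Set.subset_union_right hi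
  obtain ⟨v, hv, hs, hξ⟩ := hS.2.1.2 y hy
  obtain ⟨w, hw, hs', hξ'⟩ := hS'.2.1.2 y hy'
  have h1 := hS.2.2 y hy
  have h2 := hS'.2.2 y hy'
  rw [hξ, wedge_apply] at h1
  rw [hξ', wedge_apply] at h2
  rw [hξ, hξ']
  exact wedge_eq_of_span_eq hv (by rw [hs, hs', t1, t2]) (h1.trans h2.symm)
    (by rw [h1]; exact one_ne_zero)

/-- The orientation of the union is continuous at points near which both pieces are closed, provided
that the two orientations agree at common points. -/
theorem continuousWithinAt_unionOrientation (hS : IsSLSubmanifold θ S ξ)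
    (hS' : IsSLSubmanifold θ (f '' S) (-pushforward f ξ)) {y : EuclideanSpace ℂ (Fin (m + 1))}
    (hc : y ∈ closure S → y ∈ S) (hc' : y ∈ closure (f '' S) → y ∈ f '' S)
    (h : y ∈ S → y ∈ f '' S → ξ y = (-pushforward f ξ) y) :
    ContinuousWithinAt (unionOrientation f S ξ) (S ∪ f '' S) y := by
  rw [← Set.union_sdiff_self]
  refine ContinuousWithinAt.union ?_ ?_
  · by_cases hy : y ∈ S
    · exact (hS.2.1.1 y hy).congr (fun z hz => unionOrientation_of_mem hz)
        (unionOrientation_of_mem hy)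
    · exact continuousWithinAt_of_notMem_closure fun hcl => hy (hc hcl)
  · by_cases hy : y ∈ f '' S
    · refine ((hS'.2.1.1 y hy).mono Set.sdiff_subset).congr
        (fun z hz => unionOrientation_of_notMem hz.2) ?_
      by_cases hyS : y ∈ S
      · rw [unionOrientation_of_mem hyS, h hyS hy]
      · exact unionOrientation_of_notMem hyS
    · exact continuousWithinAt_of_notMem_closure fun hcl =>
        hy (hc' (closure_mono Set.sdiff_subset hcl))

theorem exists_frame_unionOrientation (hS : IsSLSubmanifold θ S ξ)
    (hS' : IsSLSubmanifold θ (f '' S) (-pushforward f ξ)) {y : EuclideanSpace ℂ (Fin (m + 1))}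
    (hy : y ∈ S ∪ f '' S) (h : y ∈ S → tangentSpace S y = tangentSpace (S ∪ f '' S) y)
    (h' : y ∈ f '' S → y ∉ S → tangentSpace (f '' S) y = tangentSpace (S ∪ f '' S) y) :
    ∃ v : Fin (m + 1) → EuclideanSpace ℂ (Fin (m + 1)), Orthonormal ℝ v ∧
      Submodule.span ℝ (Set.range v) = tangentSpace (S ∪ f '' S) y ∧
      unionOrientation f S ξ y = wedge v := by
  by_cases hyS : y ∈ S
  · obtain ⟨v, hv, hs, hξ⟩ := hS.2.1.2 y hyS
    exact ⟨v, hv, hs.trans (h hyS), by rw [unionOrientation_of_mem hyS, hξ]⟩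
  · have hy' := hy.resolve_left hyS
    obtain ⟨v, hv, hs, hξ⟩ := hS'.2.1.2 y hy'
    exact ⟨v, hv, hs.trans (h' hy' hyS), by rw [unionOrientation_of_notMem hyS, hξ]⟩

theorem unionOrientation_slForm (hS : IsSLSubmanifold θ S ξ)
    (hS' : IsSLSubmanifold θ (f '' S) (-pushforward f ξ)) {y : EuclideanSpace ℂ (Fin (m + 1))}
    (hy : y ∈ S ∪ f '' S) : unionOrientation f S ξ y (slForm (m + 1) θ) = 1 := by
  by_cases hyS : y ∈ S
  · rw [unionOrientation_of_mem hyS]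
    exact hS.2.2 y hyS
  · rw [unionOrientation_of_notMem hyS]
    exact hS'.2.2 y (hy.resolve_left hyS)

/-- In a neighbourhood of `L` the union is special Lagrangian without boundary. -/
theorem exists_isSLSubmanifold_inter (hS : IsSLSubmanifold θ S ξ)
    (hP : Module.finrank ℂ P.direction = m) (hW : IsOpen W)
    (hL : L = boundary (m + 1) S ∩ W) (hLP : L ⊆ P)
    (hf : f = EuclideanGeometry.reflection P) :
    ∃ U, IsOpen U ∧ L ⊆ U ∧
      IsSLSubmanifold θ ((S ∪ f '' S) ∩ U) (unionOrientation f S ξ) ∧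
      boundary (m + 1) ((S ∪ f '' S) ∩ U) = ∅ := by
  have hS' := hS.reflect hP hf
  choose! U hUo hxU hUi hUc hUc' using
    fun x (hx : x ∈ L) => exists_nhds_union hS hP hW hL hLP hf hx
  have hUo' : IsOpen (⋃ x ∈ L, U x) := isOpen_biUnion hUo
  have hint : ∀ y ∈ (S ∪ f '' S) ∩ ⋃ x ∈ L, U x,
      IsInteriorPoint (m + 1) (S ∪ f '' S) y := by
    rintro y ⟨hy, hyU⟩
    obtain ⟨x, hx, hyx⟩ := Set.mem_iUnion₂.1 hyU
    exact hUi x hx y hyx hy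
  have hint' : ∀ y ∈ (S ∪ f '' S) ∩ ⋃ x ∈ L, U x,
      IsInteriorPoint (m + 1) ((S ∪ f '' S) ∩ ⋃ x ∈ L, U x) y := fun y hy =>
    (hint y hy).congr hUo' hy.2 fun z hz => ⟨fun h => ⟨h, hz⟩, fun h => h.1⟩
  refine ⟨_, hUo', fun x hx => Set.mem_biUnion hx (hxU x hx),
    ⟨fun y hy => Or.inl (hint' y hy), ⟨fun y hy => ?_, fun y hy => ?_⟩,
      fun y hy => unionOrientation_slForm hS hS' hy.1⟩, ?_⟩
  · obtain ⟨x, hx, hyx⟩ := Set.mem_iUnion₂.1 hy.2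
    exact (continuousWithinAt_unionOrientation hS hS' (fun h => hUc x hx ⟨h, hyx⟩)
      (fun h => hUc' x hx ⟨h, hyx⟩)
      fun h h' => orientation_eq_of_mem_inter hS hS' h h' (hint y hy)).mono Set.inter_subset_left
  · rw [tangentSpace_inter_nhds (hUo'.mem_nhds hy.2)]
    exact exists_frame_unionOrientation hS hS' hy.1
      (fun h => tangentSpace_eq_of_isInteriorPoint hS.2.1 h Set.subset_union_left (hint y hy))
      fun h _ => tangentSpace_eq_of_isInteriorPoint hS'.2.1 h Set.subset_union_right (hint y hy)
  · refine Set.eq_empty_of_forall_notMem fun y hy => ?_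
    exact (hint' y hy.1).not_isBoundaryPoint hy

/-- If the two pieces meet along `L` only, the union is special Lagrangian, and its boundary is what
remains of the two boundaries. Away from `L` the union locally coincides with one of the pieces. -/
theorem isSLSubmanifold_union (hS : IsSLSubmanifold θ S ξ)
    (hP : Module.finrank ℂ P.direction = m) (hW : IsOpen W)
    (hL : L = boundary (m + 1) S ∩ W) (hLP : L ⊆ P)
    (hf : f = EuclideanGeometry.reflection P) (hmeet : S ∩ closure (f '' S) ⊆ L) :
    IsSLSubmanifold θ (S ∪ f '' S) (unionOrientation f S ξ) ∧
      boundary (m + 1) (S ∪ f '' S) =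
        (boundary (m + 1) S \ L) ∪ f '' (boundary (m + 1) S \ L) := by
  have hS' := hS.reflect hP hf
  have hLS : L ⊆ S := fun x hx => (hL ▸ hx : x ∈ boundary (m + 1) S ∩ W).1.1
  have hfL : ∀ x ∈ L, f x = x := fun x hx => reflection_of_mem hf (hLP hx)
  have hbf : boundary (m + 1) (f '' S) = f '' boundary (m + 1) S :=
    boundary_image S f.toHomeomorph (contDiff_affineIsometryEquiv f)
      (contDiff_affineIsometryEquiv f.symm)
  have hclf : closure (f '' S) = f '' closure S := (f.toHomeomorph.image_closure S).symm
  have hfar : ∀ y ∈ S, y ∉ L → y ∉ closure (f '' S) := fun y hy hyL hcl => hyL (hmeet ⟨hy, hcl⟩)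
  have hfar' : ∀ y ∈ f '' S, y ∉ S → y ∉ closure S := by
    intro y hy hyS hcl
    have h1 : f y ∈ S := (mem_image_reflection hf).1 hy
    have h2 : f y ∈ L := hmeet ⟨h1, by rw [hclf]; exact ⟨y, hcl, rfl⟩⟩
    have h3 := hfL _ h2
    rw [reflection_involutive hf] at h3
    exact hyS (h3 ▸ h1)
  have hloc : ∀ y ∈ (closure (f '' S))ᶜ, (y ∈ S ↔ y ∈ S ∪ f '' S) := fun y hy =>
    ⟨Or.inl, fun h => h.resolve_right fun h' => hy (subset_closure h')⟩
  have hloc' : ∀ y ∈ (closure S)ᶜ, (y ∈ f '' S ↔ y ∈ S ∪ f '' S) := fun y hy =>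
    ⟨Or.inr, fun h => h.resolve_left fun h' => hy (subset_closure h')⟩
  have ho : IsOpen (closure (f '' S))ᶜ := isClosed_closure.isOpen_compl
  have ho' : IsOpen (closure S)ᶜ := isClosed_closure.isOpen_compl
  have hintL : ∀ y ∈ L, IsInteriorPoint (m + 1) (S ∪ f '' S) y := fun y hy => by
    obtain ⟨U, -, hyU, hi, -⟩ := exists_nhds_union hS hP hW hL hLP hf hy
    exact hi y hyU (Or.inl (hLS hy))
  refine ⟨⟨fun y hy => ?_, ⟨fun y hy => ?_, fun y hy => ?_⟩,
    fun y hy => unionOrientation_slForm hS hS' hy⟩, ?_⟩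
  · by_cases hyL : y ∈ L
    · exact Or.inl (hintL y hyL)
    by_cases hyS : y ∈ S
    · have hn := hfar y hyS hyL
      exact (hS.1 y hyS).imp (fun h => h.congr ho hn hloc) fun h => h.congr ho hn hloc
    · have hy' := hy.resolve_left hyS
      have hn := hfar' y hy' hyS
      exact (hS'.1 y hy').imp (fun h => h.congr ho' hn hloc') fun h => h.congr ho' hn hloc'
  · refine continuousWithinAt_unionOrientation hS hS' (fun h => ?_) (fun h => ?_)
      fun h h' => orientation_eq_of_mem_inter hS hS' h h' (hintL y (hmeet ⟨h, subset_closure h'⟩))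
    · by_contra hyS
      exact hfar' y (hy.resolve_left hyS) hyS h
    · rcases hy with hy | hy
      · have hyL := hmeet ⟨hy, h⟩
        exact ⟨y, hy, hfL y hyL⟩
      · exact hy
  · refine exists_frame_unionOrientation hS hS' hy (fun h => ?_) fun h h' =>
      tangentSpace_congr (ho'.mem_nhds (hfar' y h h')) hloc'
    by_cases hyL : y ∈ L
    · exact tangentSpace_eq_of_isInteriorPoint hS.2.1 h Set.subset_union_left (hintL y hyL)
    · exact tangentSpace_congr (ho.mem_nhds (hfar y h hyL)) hloc
  · ext y
    constructor
    · intro hy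
      have hyL : y ∉ L := fun h => (hintL y h).not_isBoundaryPoint hy
      by_cases hyS : y ∈ S
      · exact Or.inl ⟨hy.congr ho (hfar y hyS hyL) fun z hz => (hloc z hz).symm, hyL⟩
      · have hy' : y ∈ f '' S := Or.resolve_left hy.1 hyS
        have hb : y ∈ boundary (m + 1) (f '' S) :=
          hy.congr ho' (hfar' y hy' hyS) fun z hz => (hloc' z hz).symm
        rw [hbf] at hb
        obtain ⟨z, hz, rfl⟩ := hb
        refine Or.inr ⟨z, ⟨hz, fun hzL => hyL ?_⟩, rfl⟩
        rwa [hfL z hzL]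
    · rintro (⟨hy, hyL⟩ | ⟨z, ⟨hz, hzL⟩, rfl⟩)
      · exact hy.congr ho (hfar y hy.1 hyL) hloc
      · have hzn : f z ∉ S := fun h =>
          hzL (hmeet ⟨hz.1, subset_closure ((mem_image_reflection hf).2 h)⟩)
        have hb : f z ∈ boundary (m + 1) (f '' S) := by
          rw [hbf]
          exact ⟨z, hz, rfl⟩
        exact IsBoundaryPoint.congr hb ho' (hfar' _ ⟨z, hz.1, rfl⟩ hzn) hloc'

end Union

end SpecialLagrangian

end

theorem mainTheorem2 (m : ℕ) (θ : ℝ)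
    (S : Set (EuclideanSpace ℂ (Fin (m + 1))))
    (ξ : EuclideanSpace ℂ (Fin (m + 1)) → MultiVector (EuclideanSpace ℂ (Fin (m + 1))) (m + 1))
    (hS : IsSLSubmanifold θ S ξ)
    (P : AffineSubspace ℂ (EuclideanSpace ℂ (Fin (m + 1)))) [Nonempty P]
    (hP : Module.finrank ℂ P.direction = m)
    (L : Set (EuclideanSpace ℂ (Fin (m + 1))))
    (hLopen : ∃ W, IsOpen W ∧ L = boundary (m + 1) S ∩ W)
    (hLP : L ⊆ P)
    (f : EuclideanSpace ℂ (Fin (m + 1)) ≃ᵃⁱ[ℂ] EuclideanSpace ℂ (Fin (m + 1)))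
    (hf : f = EuclideanGeometry.reflection P) :
    -- the reflected submanifold with reversed orientation is special Lagrangian of the same phase
    (IsSLSubmanifold θ (f '' S) (-pushforward f ξ) ∧
      boundary (m + 1) (f '' S) = f '' boundary (m + 1) S) ∧
    -- in a neighbourhood of `L`, the union is special Lagrangian and has no boundary
    (∃ U, IsOpen U ∧ L ⊆ U ∧
      IsSLSubmanifold θ ((S ∪ f '' S) ∩ U) (unionOrientation f S ξ) ∧
      boundary (m + 1) ((S ∪ f '' S) ∩ U) = ∅) ∧
    -- if the two pieces meet along `L` only, then the union is globally special Lagrangian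
    (S ∩ closure (f '' S) ⊆ L →
      IsSLSubmanifold θ (S ∪ f '' S) (unionOrientation f S ξ) ∧
      boundary (m + 1) (S ∪ f '' S) =
        (boundary (m + 1) S \ L) ∪ f '' (boundary (m + 1) S \ L)) ∧
    -- the union is calibrated by the same form, and area-minimizing
    (∀ x ∈ S ∪ f '' S, unionOrientation f S ξ x (slForm (m + 1) θ) = 1) ∧
    IsAreaMinimizing (S ∪ f '' S) (unionOrientation f S ξ) := by
  obtain ⟨W, hW, hL⟩ := hLopen
  have hS' := hS.reflect hP hf
  have hcal : ∀ x ∈ S ∪ f '' S, unionOrientation f S ξ x (slForm (m + 1) θ) = 1 :=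
    fun x hx => unionOrientation_slForm hS hS' hx
  exact ⟨⟨hS', boundary_image S f.toHomeomorph (contDiff_affineIsometryEquiv f)
      (contDiff_affineIsometryEquiv f.symm)⟩,
    exists_isSLSubmanifold_inter hS hP hW hL hLP hf,
    isSLSubmanifold_union hS hP hW hL hLP hf, hcal,
    isAreaMinimizing_of_calibrated (slForm (m + 1) θ) (abs_slForm_le_one θ) _ _ hcal⟩
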